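/- Let $\mathbb{K}$ be a field. All operads are symmetric operads in $\mathbb{K}$-vector spaces, binary, quadratic and finitely generated. For $\mathcal O=\mathcal P(E,R)$, $\mathcal P=\mathcal P(F,S)$ the Manin black product is $\mathcal O\bullet\mathcal P=\mathcal P(E\otimes F\otimes \mathrm{sgn}_{S_2},\Psi(R\otimes S))$, where $\Psi$ sends a pair of monomials $\mu(\nu(x_{i+1},x_{i+2}),x_i)$, $\mu'(\nu'(x_{j+1},x_{j+2}),x_j)$ (indices modulo $3$) to $(\mu\otimes\mu')((\nu\otimes\nu')(x_{i+1},x_{i+2}),x_i)$ if $i=j$ and to $0$ if $i\neq j$. Denote by $\mathcal Ass$, $\mathcal Com$ the operads of associative and of commutative associative algebras, and by - $pre\mathcal Lie$ the operad of right pre-Lie algebras: $(x\cdot y)\cdot z-x\cdot(y\cdot z)=(x\cdot z)\cdot y-x\cdot(z\cdot y)$; - $\mathcal Dend$ the operad of dendriform algebras: $(x\prec y)\prec z=x\prec(y\prec z+y\succ z)$, $(x\succ y)\prec z=x\succ(y\prec z)$, $(x\prec y+x\succ y)\succ z=x\succ(y\succ z)$; - $\mathcal Zinb$ the operad of right Zinbiel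 algebras: $(x\star y)\star z=x\star(y\star z+z\star y)$; - $L\text{-}\mathcal Dend$ the operad of $L$-dendriform algebras: two products $\prec,\succ$ without symmetry such that, with $x\cdot y:=x\prec y-y\succ x$, $$x\prec(y\cdot z-z\cdot y)=(x\prec y)\prec z-(x\prec z)\prec y,\qquad (x\succ y)\prec z=x\succ(y\cdot z)+(x\prec z+x\succ z)\succ y.$$ Then there are isomorphisms of operads $$\mathcal Ass\bullet pre\mathcal Lie\cong\mathcal Dend,\qquad \mathcal Com\bullet pre\mathcal Lie\cong\mathcal Zinb,\qquad pre\mathcal Lie\bullet pre\mathcal Lie\cong L\text{-}\mathcal Dend.$$ Moreover, let $C^*(\Delta_1;V)$ be the complex of non-degenerate cochains on the interval with coefficients in a vector space $V$, where ${}_x\!\to$ and $\to_x$ are the $0$-cochains with value $x$ on the left, respectively right, vertex and $0$ on the other one, $\xrightarrow{x}$ is the $1$-cochain with value $x$, and $d({}_x\!\to_y)=\xrightarrow{y-x}$. A dg $pre\mathcal Lie$-algebra structure on $C^*(\Delta_1;V)$ is called local if for every set $X$ of vertices the cochains which vanish on $X$ form an ideal. For every vector space $V$: 1. ($\mathrm{Ass}_\bullet(pre\mathcal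 Lie)=\mathcal Dend$) the formulas ${}_x\!\to\cdot'\xrightarrow{y}=\xrightarrow{x}\cdot'\to_y=\xrightarrow{x\prec y}$ and $\to_x\cdot'\xrightarrow{y}=\xrightarrow{x}\cdot'{}_y\!\to=-\xrightarrow{y\succ x}$ define a bijection between local dg $pre\mathcal Lie$-algebra structures $\cdot'$ on $C^*(\Delta_1;V)$ and dendriform algebra structures $(\prec,\succ)$ on $V$; 2. ($\mathrm{Com}_\bullet(pre\mathcal Lie)=\mathcal Zinb$) the same formulas, with $x\prec y=y\succ x=:x\star y$, define a bijection between local dg $pre\mathcal Lie$-algebra structures $\cdot'$ on $C^*(\Delta_1;V)$ such that $\to_x\cdot'\to_y=0$ for all $x,y$ and right Zinbiel algebra structures $\star$ on $V$; 3. ($\mathrm{preLie}_\bullet(pre\mathcal Lie)=L\text{-}\mathcal Dend$) the formulas $\xrightarrow{x}\cdot'\to_y=\xrightarrow{x\prec y}$ and $\to_x\cdot'\xrightarrow{y}=-\xrightarrow{y\succ x}$ define a bijection between dg $pre\mathcal Lie$-algebra structures $\cdot'$ on the complex $C^*(\Delta_1,v_l;V)$ of cochains which vanish on the left vertex and $L$-dendriform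 algebra structures $(\prec,\succ)$ on $V$. -/

import Mathlib

open scoped TensorProduct

universe u v w

noncomputable section

namespace Operads

/-! ## Symmetric operads in vector spaces -/

/-- `X ⊔ (Y ⊔ {*}) ≃ (X ⊔ Y) ⊔ {*}`. -/
def optRight (X Y : Type) : X ⊕ Option Y ≃ Option (X ⊕ Y) where
  toFun
    | .inl x => some (.inl x)
    | .inr none => none
    | .inr (some y) => some (.inr y)
  invFun
    | none => .inr none
    | some (.inl x) => .inl x
    | some (.inr y) => .inr (some y)
  left_inv := by rintro (x | _ | y) <;> rfl
  right_inv := by rintro (_ | x | y) <;> rfl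

/-- `(X ⊔ {*}) ⊔ Y ≃ (X ⊔ Y) ⊔ {*}`. -/
def optLeft (X Y : Type) : Option X ⊕ Y ≃ Option (X ⊕ Y) where
  toFun
    | .inl none => none
    | .inl (some x) => some (.inl x)
    | .inr y => some (.inr y)
  invFun
    | none => .inl none
    | some (.inl x) => .inl (some x)
    | some (.inr y) => .inr y
  left_inv := by rintro ((_ | x) | y) <;> rfl
  right_inv := by rintro (_ | x | y) <;> rfl

/-- The exchange of the two added points of `(X ⊔ {*}) ⊔ {*}`. -/
def optSwap (X : Type) : Option (Option X) ≃ Option (Option X) where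
  toFun
    | none => some none
    | some none => none
    | some (some x) => some (some x)
  invFun
    | none => some none
    | some none => none
    | some (some x) => some (some x)
  left_inv := by rintro (_ | _ | x) <;> rfl
  right_inv := by rintro (_ | _ | x) <;> rfl

/-- `(X ⊔ Z) ⊔ Y ≃ (X ⊔ Y) ⊔ Z`. -/
def sumSwapRight (X Y Z : Type) : (X ⊕ Z) ⊕ Y ≃ (X ⊕ Y) ⊕ Z where
  toFun
    | .inl (.inl x) => .inl (.inl x)
    | .inl (.inr z) => .inr z
    | .inr y => .inl (.inr y)
  invFun
    | .inl (.inl x) => .inl (.inl x)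
    | .inl (.inr y) => .inr y
    | .inr z => .inl (.inr z)
  left_inv := by rintro ((x | z) | y) <;> rfl
  right_inv := by rintro ((x | y) | z) <;> rfl

/-- `{*} ≃ ∅ ⊔ {*}`. -/
def unitOpt : Unit ≃ Option Empty where
  toFun _ := none
  invFun _ := ()
  left_inv _ := rfl
  right_inv := by rintro (_ | ⟨⟨⟩⟩); rfl

/-- A (unital) symmetric operad in vector spaces over `K`, in the form of the partial definition
over finite sets: `obj X` is the space of operations whose inputs are labelled by the finite
set `X`, `map` is relabelling of the inputs, and
`comp : P(X ⊔ {*}) ⊗ P(Y) → P(X ⊔ Y)` plugs the second operation in the input `*` of the first. -/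
structure SymOperad (K : Type u) [Field K] where
  obj : (X : Type) → [Finite X] → Type v
  [acg : ∀ (X : Type) [Finite X], AddCommGroup (obj X)]
  [mod : ∀ (X : Type) [Finite X], Module K (obj X)]
  map : ∀ {X Y : Type} [Finite X] [Finite Y], X ≃ Y → obj X →ₗ[K] obj Y
  one : obj Unit
  comp : ∀ {X Y : Type} [Finite X] [Finite Y],
    obj (Option X) →ₗ[K] obj Y →ₗ[K] obj (X ⊕ Y)
  map_refl : ∀ {X : Type} [Finite X] (a : obj X), map (Equiv.refl X) a = a
  map_trans : ∀ {X Y Z : Type} [Finite X] [Finite Y] [Finite Z] (e : X ≃ Y) (f : Y ≃ Z)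
    (a : obj X), map (e.trans f) a = map f (map e a)
  /-- equivariance of the partial compositions -/
  comp_map : ∀ {X Y X' Y' : Type} [Finite X] [Finite Y] [Finite X'] [Finite Y']
    (e : X ≃ X') (f : Y ≃ Y') (a : obj (Option X)) (b : obj Y),
    comp (map e.optionCongr a) (map f b) = map (e.sumCongr f) (comp a b)
  comp_one : ∀ {X : Type} [Finite X] (a : obj (Option X)),
    comp a one = map (Equiv.optionEquivSumPUnit X) a
  one_comp : ∀ {Y : Type} [Finite Y] (b : obj Y),
    comp (map unitOpt one) b = map (Equiv.emptySum Empty Y).symm b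
  /-- sequential composition axiom -/
  comp_seq : ∀ {X Y Z : Type} [Finite X] [Finite Y] [Finite Z]
    (a : obj (Option X)) (b : obj (Option Y)) (c : obj Z),
    map (Equiv.sumAssoc X Y Z) (comp (map (optRight X Y) (comp a b)) c) = comp a (comp b c)
  /-- parallel composition axiom -/
  comp_par : ∀ {X Y Z : Type} [Finite X] [Finite Y] [Finite Z]
    (a : obj (Option (Option X))) (b : obj Y) (c : obj Z),
    comp (map (optLeft X Y) (comp a b)) c =
      map (sumSwapRight X Y Z)
        (comp (map (optLeft X Z) (comp (map (optSwap X) a) c)) b)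

attribute [instance] SymOperad.acg SymOperad.mod

/-- An isomorphism of operads. -/
structure SymOperad.Iso {K : Type u} [Field K] (P : SymOperad.{u, v} K) (Q : SymOperad.{u, w} K)
    where
  equiv : ∀ (X : Type) [Finite X], P.obj X ≃ₗ[K] Q.obj X
  equiv_map : ∀ {X Y : Type} [Finite X] [Finite Y] (e : X ≃ Y) (a : P.obj X),
    equiv Y (P.map e a) = Q.map e (equiv X a)
  equiv_one : equiv Unit P.one = Q.one
  equiv_comp : ∀ {X Y : Type} [Finite X] [Finite Y] (a : P.obj (Option X)) (b : P.obj Y),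
    equiv (X ⊕ Y) (P.comp a b) = Q.comp (equiv (Option X) a) (equiv Y b)

/-! ## Operadic ideals and quotients -/

section Quotient

variable {K : Type u} [Field K] (P : SymOperad.{u, v} K)

/-- Membership in the operadic ideal generated by a set `S` of operations with three inputs. -/
inductive InIdeal (S : Set (P.obj (Fin 3))) : (X : Type) → [Finite X] → P.obj X → Prop
  | of {r : P.obj (Fin 3)} : r ∈ S → InIdeal S (Fin 3) r
  | zero (X : Type) [Finite X] : InIdeal S X 0
  | add {X : Type} [Finite X] {a b : P.obj X} :
      InIdeal S X a → InIdeal S X b → InIdeal S X (a + b)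
  | smul {X : Type} [Finite X] (c : K) {a : P.obj X} : InIdeal S X a → InIdeal S X (c • a)
  | map {X Y : Type} [Finite X] [Finite Y] (e : X ≃ Y) {a : P.obj X} :
      InIdeal S X a → InIdeal S Y (P.map e a)
  | comp_left {X Y : Type} [Finite X] [Finite Y] {a : P.obj (Option X)} (b : P.obj Y) :
      InIdeal S (Option X) a → InIdeal S (X ⊕ Y) (P.comp a b)
  | comp_right {X Y : Type} [Finite X] [Finite Y] (a : P.obj (Option X)) {b : P.obj Y} :
      InIdeal S Y b → InIdeal S (X ⊕ Y) (P.comp a b)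

/-- The operadic ideal generated by a set `S` of operations with three inputs. -/
def ideal (S : Set (P.obj (Fin 3))) (X : Type) [Finite X] : Submodule K (P.obj X) where
  carrier := {a | InIdeal P S X a}
  add_mem' := InIdeal.add
  zero_mem' := InIdeal.zero X
  smul_mem' c _ h := InIdeal.smul c h

/-- The relabelling maps of the quotient operad. -/
def quotientMap (S : Set (P.obj (Fin 3))) {X Y : Type} [Finite X] [Finite Y] (e : X ≃ Y) :
    (P.obj X ⧸ ideal P S X) →ₗ[K] (P.obj Y ⧸ ideal P S Y) :=
  (ideal P S X).mapQ (ideal P S Y) (P.map e) (fun _ h => by exact InIdeal.map e h)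

/-- The partial compositions of the quotient operad. -/
def quotientComp (S : Set (P.obj (Fin 3))) {X Y : Type} [Finite X] [Finite Y] :
    (P.obj (Option X) ⧸ ideal P S (Option X)) →ₗ[K] (P.obj Y ⧸ ideal P S Y) →ₗ[K]
      (P.obj (X ⊕ Y) ⧸ ideal P S (X ⊕ Y)) :=
  (ideal P S (Option X)).liftQ
    (((ideal P S Y).liftQ
      ((P.comp (X := X) (Y := Y)).flip.compr₂ (ideal P S (X ⊕ Y)).mkQ)
      (by
        intro b hb
        rw [LinearMap.mem_ker]
        ext a
        simp only [LinearMap.compr₂_apply, LinearMap.flip_apply, LinearMap.zero_apply,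
          Submodule.mkQ_apply, Submodule.Quotient.mk_eq_zero]
        exact InIdeal.comp_right a hb)).flip)
    (by
      intro a ha
      rw [LinearMap.mem_ker]
      ext b
      simp only [LinearMap.comp_apply, LinearMap.flip_apply, Submodule.mkQ_apply,
        Submodule.liftQ_apply, LinearMap.compr₂_apply, LinearMap.zero_apply,
        Submodule.Quotient.mk_eq_zero]
      exact InIdeal.comp_left b ha)

theorem quotientMap_mk (S : Set (P.obj (Fin 3))) {X Y : Type} [Finite X] [Finite Y] (e : X ≃ Y)
    (a : P.obj X) : quotientMap P S e (Submodule.Quotient.mk a) =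
      Submodule.Quotient.mk (P.map e a) := rfl

theorem quotientComp_mk (S : Set (P.obj (Fin 3))) {X Y : Type} [Finite X] [Finite Y]
    (a : P.obj (Option X)) (b : P.obj Y) :
    quotientComp P S (Submodule.Quotient.mk a) (Submodule.Quotient.mk b) =
      Submodule.Quotient.mk (P.comp a b) := rfl

/-- The quotient of an operad by the operadic ideal generated by `S`. -/
def quotientOperad (S : Set (P.obj (Fin 3))) : SymOperad.{u, v} K where
  obj X _ := P.obj X ⧸ ideal P S X
  map e := quotientMap P S e
  one := Submodule.Quotient.mk P.one
  comp := quotientComp P S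
  map_refl a := by
    obtain ⟨a, rfl⟩ := Submodule.Quotient.mk_surjective _ a
    rw [quotientMap_mk, P.map_refl]
  map_trans e f a := by
    obtain ⟨a, rfl⟩ := Submodule.Quotient.mk_surjective _ a
    simp only [quotientMap_mk, P.map_trans]
  comp_map e f a b := by
    obtain ⟨a, rfl⟩ := Submodule.Quotient.mk_surjective _ a
    obtain ⟨b, rfl⟩ := Submodule.Quotient.mk_surjective _ b
    simp only [quotientMap_mk, quotientComp_mk, P.comp_map]
  comp_one a := by
    obtain ⟨a, rfl⟩ := Submodule.Quotient.mk_surjective _ a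
    simp only [quotientMap_mk, quotientComp_mk, P.comp_one]
  one_comp b := by
    obtain ⟨b, rfl⟩ := Submodule.Quotient.mk_surjective _ b
    simp only [quotientMap_mk, quotientComp_mk, P.one_comp]
  comp_seq a b c := by
    obtain ⟨a, rfl⟩ := Submodule.Quotient.mk_surjective _ a
    obtain ⟨b, rfl⟩ := Submodule.Quotient.mk_surjective _ b
    obtain ⟨c, rfl⟩ := Submodule.Quotient.mk_surjective _ c
    simp only [quotientMap_mk, quotientComp_mk, P.comp_seq]
  comp_par a b c := by
    obtain ⟨a, rfl⟩ := Submodule.Quotient.mk_surjective _ a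
    obtain ⟨b, rfl⟩ := Submodule.Quotient.mk_surjective _ b
    obtain ⟨c, rfl⟩ := Submodule.Quotient.mk_surjective _ c
    simp only [quotientMap_mk, quotientComp_mk]
    rw [P.comp_par a b c]

end Quotient

/-! ## The free operad on a space of binary operations -/

section Free

variable (K : Type u) [Field K] (E : Type u) [AddCommGroup E] [Module K E] (τ : E →ₗ[K] E)

/-- Formal expressions in the operad structure, in a space `E` of binary generators. -/
inductive Pre : Type → Type (max 1 u)
  | gen : E → Pre (Fin 2)
  | one : Pre Unit
  | zero (X : Type) [Finite X] : Pre X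
  | add {X : Type} [Finite X] : Pre X → Pre X → Pre X
  | smul {X : Type} [Finite X] : K → Pre X → Pre X
  | map {X Y : Type} [Finite X] [Finite Y] : X ≃ Y → Pre X → Pre Y
  | comp {X Y : Type} [Finite X] [Finite Y] : Pre (Option X) → Pre Y → Pre (X ⊕ Y)

/-- The smallest congruence on formal expressions which makes them an operad and for which
`Pre.gen` is linear and intertwines `τ` with the exchange of the two inputs. -/
inductive Rel : {X : Type} → Pre K E X → Pre K E X → Prop
  | refl {X : Type} (a : Pre K E X) : Rel a a
  | symm {X : Type} {a b : Pre K E X} : Rel a b → Rel b a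
  | trans {X : Type} {a b c : Pre K E X} : Rel a b → Rel b c → Rel a c
  | add {X : Type} [Finite X] {a a' b b' : Pre K E X} :
      Rel a a' → Rel b b' → Rel (a.add b) (a'.add b')
  | smul {X : Type} [Finite X] (c : K) {a a' : Pre K E X} :
      Rel a a' → Rel (Pre.smul c a) (Pre.smul c a')
  | map {X Y : Type} [Finite X] [Finite Y] (e : X ≃ Y) {a a' : Pre K E X} :
      Rel a a' → Rel (Pre.map e a) (Pre.map e a')
  | comp {X Y : Type} [Finite X] [Finite Y] {a a' : Pre K E (Option X)} {b b' : Pre K E Y} :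
      Rel a a' → Rel b b' → Rel (Pre.comp a b) (Pre.comp a' b')
  -- vector space axioms
  | add_comm {X : Type} [Finite X] (a b : Pre K E X) : Rel (a.add b) (b.add a)
  | add_assoc {X : Type} [Finite X] (a b c : Pre K E X) :
      Rel ((a.add b).add c) (a.add (b.add c))
  | zero_add {X : Type} [Finite X] (a : Pre K E X) : Rel ((Pre.zero X).add a) a
  | zero_smul {X : Type} [Finite X] (a : Pre K E X) : Rel (Pre.smul 0 a) (Pre.zero X)
  | smul_zero {X : Type} [Finite X] (c : K) : Rel (Pre.smul c (Pre.zero X)) (Pre.zero X)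
  | one_smul {X : Type} [Finite X] (a : Pre K E X) : Rel (Pre.smul 1 a) a
  | mul_smul {X : Type} [Finite X] (c d : K) (a : Pre K E X) :
      Rel (Pre.smul (c * d) a) (Pre.smul c (Pre.smul d a))
  | add_smul {X : Type} [Finite X] (c d : K) (a : Pre K E X) :
      Rel (Pre.smul (c + d) a) ((Pre.smul c a).add (Pre.smul d a))
  | smul_add {X : Type} [Finite X] (c : K) (a b : Pre K E X) :
      Rel (Pre.smul c (a.add b)) ((Pre.smul c a).add (Pre.smul c b))
  -- linearity of the operad structure
  | map_add {X Y : Type} [Finite X] [Finite Y] (e : X ≃ Y) (a b : Pre K E X) :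
      Rel (Pre.map e (a.add b)) ((Pre.map e a).add (Pre.map e b))
  | map_smul {X Y : Type} [Finite X] [Finite Y] (e : X ≃ Y) (c : K) (a : Pre K E X) :
      Rel (Pre.map e (Pre.smul c a)) (Pre.smul c (Pre.map e a))
  | comp_add_left {X Y : Type} [Finite X] [Finite Y] (a a' : Pre K E (Option X))
      (b : Pre K E Y) : Rel (Pre.comp (a.add a') b) ((Pre.comp a b).add (Pre.comp a' b))
  | comp_smul_left {X Y : Type} [Finite X] [Finite Y] (c : K) (a : Pre K E (Option X))
      (b : Pre K E Y) : Rel (Pre.comp (Pre.smul c a) b) (Pre.smul c (Pre.comp a b))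
  | comp_add_right {X Y : Type} [Finite X] [Finite Y] (a : Pre K E (Option X))
      (b b' : Pre K E Y) : Rel (Pre.comp a (b.add b')) ((Pre.comp a b).add (Pre.comp a b'))
  | comp_smul_right {X Y : Type} [Finite X] [Finite Y] (c : K) (a : Pre K E (Option X))
      (b : Pre K E Y) : Rel (Pre.comp a (Pre.smul c b)) (Pre.smul c (Pre.comp a b))
  -- operad axioms
  | map_refl {X : Type} [Finite X] (a : Pre K E X) : Rel (Pre.map (Equiv.refl X) a) a
  | map_trans {X Y Z : Type} [Finite X] [Finite Y] [Finite Z] (e : X ≃ Y) (f : Y ≃ Z)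
      (a : Pre K E X) : Rel (Pre.map (e.trans f) a) (Pre.map f (Pre.map e a))
  | comp_map {X Y X' Y' : Type} [Finite X] [Finite Y] [Finite X'] [Finite Y']
      (e : X ≃ X') (f : Y ≃ Y') (a : Pre K E (Option X)) (b : Pre K E Y) :
      Rel (Pre.comp (Pre.map e.optionCongr a) (Pre.map f b))
        (Pre.map (e.sumCongr f) (Pre.comp a b))
  | comp_one {X : Type} [Finite X] (a : Pre K E (Option X)) :
      Rel (Pre.comp a Pre.one) (Pre.map (Equiv.optionEquivSumPUnit X) a)
  | one_comp {Y : Type} [Finite Y] (b : Pre K E Y) :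
      Rel (Pre.comp (Pre.map unitOpt Pre.one) b) (Pre.map (Equiv.emptySum Empty Y).symm b)
  | comp_seq {X Y Z : Type} [Finite X] [Finite Y] [Finite Z]
      (a : Pre K E (Option X)) (b : Pre K E (Option Y)) (c : Pre K E Z) :
      Rel (Pre.map (Equiv.sumAssoc X Y Z) (Pre.comp (Pre.map (optRight X Y) (Pre.comp a b)) c))
        (Pre.comp a (Pre.comp b c))
  | comp_par {X Y Z : Type} [Finite X] [Finite Y] [Finite Z]
      (a : Pre K E (Option (Option X))) (b : Pre K E Y) (c : Pre K E Z) :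
      Rel (Pre.comp (Pre.map (optLeft X Y) (Pre.comp a b)) c)
        (Pre.map (sumSwapRight X Y Z)
          (Pre.comp (Pre.map (optLeft X Z) (Pre.comp (Pre.map (optSwap X) a) c)) b))
  -- the generators
  | gen_add (μ ν : E) : Rel (Pre.gen (μ + ν)) ((Pre.gen μ).add (Pre.gen ν))
  | gen_smul (c : K) (μ : E) : Rel (Pre.gen (c • μ)) (Pre.smul c (Pre.gen μ))
  | gen_swap (μ : E) : Rel (Pre.gen (τ μ)) (Pre.map (Equiv.swap 0 1) (Pre.gen μ))

/-- The congruence as a setoid. -/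
def relSetoid (X : Type) : Setoid (Pre K E X) where
  r := Rel K E τ
  iseqv := ⟨Rel.refl, Rel.symm, Rel.trans⟩

/-- The operations of the free operad with inputs labelled by `X`. -/
def FreeObj (X : Type) : Type (max 1 u) := Quotient (relSetoid K E τ X)

variable {K E}

/-- The class of a formal expression. -/
def FreeObj.mk {X : Type} (a : Pre K E X) : FreeObj K E τ X := Quotient.mk (relSetoid K E τ X) a

instance FreeObj.hasAdd (X : Type) [Finite X] : Add (FreeObj K E τ X) where
  add := Quotient.map₂ Pre.add (fun _ _ h _ _ h' => Rel.add h h')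

instance FreeObj.hasZero (X : Type) [Finite X] : Zero (FreeObj K E τ X) where
  zero := FreeObj.mk τ (Pre.zero X)

instance FreeObj.hasNeg (X : Type) [Finite X] : Neg (FreeObj K E τ X) where
  neg := Quotient.map (Pre.smul (-1)) (fun _ _ h => Rel.smul _ h)

instance FreeObj.addCommGroup (X : Type) [Finite X] : AddCommGroup (FreeObj K E τ X) where
  nsmul := nsmulRec
  zsmul := zsmulRec
  add_assoc := by
    rintro ⟨a⟩ ⟨b⟩ ⟨c⟩
    exact Quotient.sound (Rel.add_assoc a b c)
  zero_add := by
    rintro ⟨a⟩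
    exact Quotient.sound (Rel.zero_add a)
  add_zero := by
    rintro ⟨a⟩
    exact Quotient.sound ((Rel.add_comm _ _).trans (Rel.zero_add a))
  add_comm := by
    rintro ⟨a⟩ ⟨b⟩
    exact Quotient.sound (Rel.add_comm a b)
  neg_add_cancel := by
    rintro ⟨a⟩
    refine Quotient.sound (Rel.trans (Rel.add (Rel.refl _) (Rel.symm (Rel.one_smul a))) ?_)
    refine Rel.trans (Rel.symm (Rel.add_smul _ _ _)) ?_
    rw [neg_add_cancel]
    exact Rel.zero_smul a

instance FreeObj.module (X : Type) [Finite X] : Module K (FreeObj K E τ X) where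
  smul c := Quotient.map (Pre.smul c) (fun _ _ h => Rel.smul _ h)
  one_smul := by
    rintro ⟨a⟩
    exact Quotient.sound (Rel.one_smul a)
  mul_smul := by
    rintro c d ⟨a⟩
    exact Quotient.sound (Rel.mul_smul c d a)
  smul_zero c := Quotient.sound (Rel.smul_zero c)
  smul_add := by
    rintro c ⟨a⟩ ⟨b⟩
    exact Quotient.sound (Rel.smul_add c a b)
  add_smul := by
    rintro c d ⟨a⟩
    exact Quotient.sound (Rel.add_smul c d a)
  zero_smul := by
    rintro ⟨a⟩
    exact Quotient.sound (Rel.zero_smul a)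

/-- The free operad on the space `E` of binary operations, where `τ` is the action on `E` of the
exchange of the two inputs. -/
def freeOperad : SymOperad.{u, max 1 u} K where
  obj X _ := FreeObj K E τ X
  acg X _ := FreeObj.addCommGroup τ X
  mod X _ := FreeObj.module τ X
  map e :=
    { toFun := Quotient.map (Pre.map e) (fun _ _ h => Rel.map e h)
      map_add' := by
        rintro ⟨a⟩ ⟨b⟩
        exact Quotient.sound (Rel.map_add e a b)
      map_smul' := by
        rintro c ⟨a⟩
        exact Quotient.sound (Rel.map_smul e c a) }
  one := FreeObj.mk τ Pre.one
  comp := LinearMap.mk₂ K (Quotient.map₂ Pre.comp (fun _ _ h _ _ h' => Rel.comp h h'))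
    (by
      rintro ⟨a⟩ ⟨a'⟩ ⟨b⟩
      exact Quotient.sound (Rel.comp_add_left a a' b))
    (by
      rintro c ⟨a⟩ ⟨b⟩
      exact Quotient.sound (Rel.comp_smul_left c a b))
    (by
      rintro ⟨a⟩ ⟨b⟩ ⟨b'⟩
      exact Quotient.sound (Rel.comp_add_right a b b'))
    (by
      rintro c ⟨a⟩ ⟨b⟩
      exact Quotient.sound (Rel.comp_smul_right c a b))
  map_refl := by
    rintro X _ ⟨a⟩
    exact Quotient.sound (Rel.map_refl a)
  map_trans := by
    rintro X Y Z _ _ _ e f ⟨a⟩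
    exact Quotient.sound (Rel.map_trans e f a)
  comp_map := by
    rintro X Y X' Y' _ _ _ _ e f ⟨a⟩ ⟨b⟩
    exact Quotient.sound (Rel.comp_map e f a b)
  comp_one := by
    rintro X _ ⟨a⟩
    exact Quotient.sound (Rel.comp_one a)
  one_comp := by
    rintro Y _ ⟨b⟩
    exact Quotient.sound (Rel.one_comp b)
  comp_seq := by
    rintro X Y Z _ _ _ ⟨a⟩ ⟨b⟩ ⟨c⟩
    exact Quotient.sound (Rel.comp_seq a b c)
  comp_par := by
    rintro X Y Z _ _ _ ⟨a⟩ ⟨b⟩ ⟨c⟩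
    exact Quotient.sound (Rel.comp_par a b c)

/-- The inclusion of the generators in the free operad. -/
def freeGen : E →ₗ[K] (freeOperad τ).obj (Fin 2) where
  toFun μ := FreeObj.mk τ (Pre.gen μ)
  map_add' μ ν := Quotient.sound (Rel.gen_add μ ν)
  map_smul' c μ := Quotient.sound (Rel.gen_smul c μ)

end Free

/-! ## Binary quadratic operads -/

section Quadratic

/-- The space of operations of arity three in the free operad on `E` is `E ⊗ E ⊕ E ⊗ E ⊕ E ⊗ E`:
the element `μ ⊗ ν` in the component `i : Fin 3` stands for the operation
`(x₀, x₁, x₂) ↦ μ(ν(xᵢ₊₁, xᵢ₊₂), xᵢ)`, with indices modulo three. -/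
abbrev Ternary (K : Type u) [Field K] (E : Type u) [AddCommGroup E] [Module K E] : Type u :=
  Fin 3 → E ⊗[K] E

variable {K : Type u} [Field K] {E : Type u} [AddCommGroup E] [Module K E]

/-- The action of `σ` on ternary operations, by the substitution `xⱼ ↦ x_{σ j}`: it takes
`μ(ν(xᵢ₊₁, xᵢ₊₂), xᵢ)` to `μ(ν(x_{σ(i+1)}, x_{σ(i+2)}), x_{σ i})`, where
`(σ(i+1), σ(i+2))` is `(σ i + 1, σ i + 2)` if `σ` is even and `(σ i + 2, σ i + 1)` if it is odd. -/
def permAct (τ : E →ₗ[K] E) (σ : Equiv.Perm (Fin 3)) : Ternary K E →ₗ[K] Ternary K E :=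
  LinearMap.pi fun j =>
    (if Equiv.Perm.sign σ = 1 then LinearMap.id else TensorProduct.map LinearMap.id τ) ∘ₗ
      LinearMap.proj (σ⁻¹ j)

/-- The operation `(x₀, x₁, x₂) ↦ ν(μ(x₀, x₁), x₂)`. -/
def leftComb (μ ν : E) : Ternary K E := Pi.single 2 (ν ⊗ₜ[K] μ)

/-- The operation `(x₀, x₁, x₂) ↦ μ(x₀, ν(x₁, x₂))`. -/
def rightComb (τ : E →ₗ[K] E) (μ ν : E) : Ternary K E := Pi.single 0 (τ μ ⊗ₜ[K] ν)

/-- Quadratic data for a finitely generated binary quadratic operad: a finite dimensional space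
`E` of binary generators, the action `τ` of the exchange of the inputs, and an `S₃`-stable space
`R` of relators of arity three. -/
structure QuadData (K : Type u) [Field K] where
  E : Type u
  [acg : AddCommGroup E]
  [mod : Module K E]
  [fin : FiniteDimensional K E]
  τ : E →ₗ[K] E
  τ_τ : ∀ μ, τ (τ μ) = μ
  R : Submodule K (Ternary K E)
  R_stable : ∀ (σ : Equiv.Perm (Fin 3)), ∀ r ∈ R, permAct τ σ r ∈ R

attribute [instance] QuadData.acg QuadData.mod QuadData.fin

theorem permAct_mul (τ : E →ₗ[K] E) (hτ : ∀ μ, τ (τ μ) = μ) (σ ρ : Equiv.Perm (Fin 3))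
    (r : Ternary K E) : permAct τ σ (permAct τ ρ r) = permAct τ (σ * ρ) r := by
  have h : (TensorProduct.map (LinearMap.id : E →ₗ[K] E) τ) ∘ₗ
      (TensorProduct.map (LinearMap.id : E →ₗ[K] E) τ) = LinearMap.id := by
    rw [← TensorProduct.map_comp]
    have : τ ∘ₗ τ = LinearMap.id := LinearMap.ext hτ
    rw [this, LinearMap.comp_id, TensorProduct.map_id]
  funext j
  have h' := fun t => LinearMap.congr_fun h t
  simp only [LinearMap.comp_apply, LinearMap.id_apply] at h'
  rcases Int.units_eq_one_or (Equiv.Perm.sign σ) with hs | hs <;>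
  rcases Int.units_eq_one_or (Equiv.Perm.sign ρ) with hr | hr <;>
  simp [permAct, hs, hr, h']

/-- The quadratic data with generators `E` and the `S₃`-stable space of relators spanned by the
permutations of the elements of `S`. -/
abbrev QuadData.ofRelators (E : Type u) [AddCommGroup E] [Module K E] [FiniteDimensional K E]
    (τ : E →ₗ[K] E) (hτ : ∀ μ, τ (τ μ) = μ) (S : Set (Ternary K E)) : QuadData K where
  E := E
  τ := τ
  τ_τ := hτ
  R := Submodule.span K {t | ∃ σ : Equiv.Perm (Fin 3), ∃ s ∈ S, t = permAct τ σ s}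
  R_stable := by
    intro σ r hr
    induction hr using Submodule.span_induction with
    | mem t ht =>
      obtain ⟨ρ, s, hs, rfl⟩ := ht
      exact Submodule.subset_span ⟨σ * ρ, s, hs, permAct_mul τ hτ σ ρ s⟩
    | zero => simp
    | add a b _ _ ha hb => rw [map_add]; exact add_mem ha hb
    | smul c a _ ha => rw [map_smul]; exact Submodule.smul_mem _ c ha

/-- `Fin 2 ≃ {*} ⊔ {()}`, where the input `0` becomes `*`. -/
def plugFirst : Fin 2 ≃ Option Unit where
  toFun i := if i = 0 then none else some ()
  invFun o := if o = none then 0 else 1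
  left_inv i := by revert i; decide
  right_inv o := by revert o; decide

/-- The labelling of the leaves of the tree of type `i`. -/
def treeLeaves (i : Fin 3) : Unit ⊕ Fin 2 ≃ Fin 3 where
  toFun
    | .inl _ => i
    | .inr j => if j = 0 then i + 1 else i + 2
  invFun k := if k = i then .inl () else if k = i + 1 then .inr 0 else .inr 1
  left_inv k := by revert k i; decide
  right_inv k := by revert k i; decide

/-- The value of a formal ternary operation in an operad `P`, when the generators are evaluated
by `g : E → P(2)`: the element `μ ⊗ ν` of type `i` becomes the operation
`μ(ν(xᵢ₊₁, xᵢ₊₂), xᵢ)` of `P`. -/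
def ternaryVal (P : SymOperad.{u, v} K) (g : E →ₗ[K] P.obj (Fin 2)) :
    Ternary K E →ₗ[K] P.obj (Fin 3) :=
  ∑ i : Fin 3, TensorProduct.lift
    (((P.comp ∘ₗ P.map plugFirst ∘ₗ g).compl₂ g).compr₂ (P.map (treeLeaves i))) ∘ₗ
      LinearMap.proj i

/-- The operad `P(E, R)`: the quotient of the free operad on `E` by the ideal generated by `R`. -/
def QuadData.operad (D : QuadData K) : SymOperad.{u, max 1 u} K :=
  quotientOperad (freeOperad D.τ) (ternaryVal (freeOperad D.τ) (freeGen D.τ) '' D.R)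

/-! ## The Manin black product -/

/-- The map `Ψ`: it takes two monomials `μ(ν(xᵢ₊₁, xᵢ₊₂), xᵢ)` and `μ'(ν'(xᵢ₊₁, xᵢ₊₂), xᵢ)` of the
same type `i` to the monomial with operations `μ ⊗ μ'` and `ν ⊗ ν'` of type `i`, and a pair of
monomials of distinct types to zero. -/
def blackMap {E F : Type u} [AddCommGroup E] [Module K E] [AddCommGroup F] [Module K F]
    (r : Ternary K E) (s : Ternary K F) : Ternary K (E ⊗[K] F) :=
  fun i => TensorProduct.tensorTensorTensorComm K E E F F (r i ⊗ₜ[K] s i)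

theorem permAct_blackMap {E F : Type u} [AddCommGroup E] [Module K E] [AddCommGroup F]
    [Module K F] (τ : E →ₗ[K] E) (τ' : F →ₗ[K] F) (σ : Equiv.Perm (Fin 3))
    (r : Ternary K E) (s : Ternary K F) :
    permAct (-(TensorProduct.map τ τ')) σ (blackMap r s) =
      (Equiv.Perm.sign σ : ℤ) • blackMap (permAct τ σ r) (permAct τ' σ s) := by
  funext j
  have key : ∀ (a : E ⊗[K] E) (b : F ⊗[K] F),
      TensorProduct.map LinearMap.id (TensorProduct.map τ τ')
        (TensorProduct.tensorTensorTensorComm K E E F F (a ⊗ₜ[K] b)) =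
      TensorProduct.tensorTensorTensorComm K E E F F
        (TensorProduct.map LinearMap.id τ a ⊗ₜ[K] TensorProduct.map LinearMap.id τ' b) := by
    intro a b
    induction a using TensorProduct.induction_on with
    | zero => simp
    | add a a' ha ha' => simp only [TensorProduct.add_tmul, map_add, ha, ha']
    | tmul a a' =>
      induction b using TensorProduct.induction_on with
      | zero => simp
      | add b b' hb hb' => simp only [TensorProduct.tmul_add, map_add, hb, hb']
      | tmul b b' => simp
  have hneg : ∀ t : (E ⊗[K] F) ⊗[K] (E ⊗[K] F),
      TensorProduct.map LinearMap.id (-(TensorProduct.map τ τ')) t =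
      -TensorProduct.map LinearMap.id (TensorProduct.map τ τ') t := by
    intro t
    induction t using TensorProduct.induction_on with
    | zero => simp
    | add a b ha hb => simp only [map_add, ha, hb, neg_add]
    | tmul a b => simp [TensorProduct.tmul_neg]
  rcases Int.units_eq_one_or (Equiv.Perm.sign σ) with hs | hs
  · simp [permAct, hs, blackMap]
  · simp [permAct, hs, blackMap, hneg, key]

/-- The Manin black product of `P(E, R)` and `P(F, S)`: the generators are `E ⊗ F ⊗ sgn`, and the
relators are spanned by `Ψ(R ⊗ S)`. -/
abbrev black (D D' : QuadData K) : QuadData K where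
  E := D.E ⊗[K] D'.E
  τ := -(TensorProduct.map D.τ D'.τ)
  τ_τ := by
    intro μ
    induction μ using TensorProduct.induction_on with
    | zero => simp
    | tmul a b => simp [D.τ_τ, D'.τ_τ]
    | add a b ha hb => rw [map_add, map_add, ha, hb]
  R := Submodule.span K {t | ∃ r ∈ D.R, ∃ s ∈ D'.R, t = blackMap r s}
  R_stable := by
    intro σ t ht
    induction ht using Submodule.span_induction with
    | mem t ht =>
      obtain ⟨r, hr, s, hs, rfl⟩ := ht
      rw [permAct_blackMap]
      have h : blackMap (permAct D.τ σ r) (permAct D'.τ σ s) ∈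
          Submodule.span K {t | ∃ r ∈ D.R, ∃ s ∈ D'.R, t = blackMap r s} :=
        Submodule.subset_span ⟨_, D.R_stable σ r hr, _, D'.R_stable σ s hs, rfl⟩
      exact zsmul_mem h _
    | zero => simp
    | add a b _ _ ha hb => rw [map_add]; exact add_mem ha hb
    | smul c a _ ha => rw [map_smul]; exact Submodule.smul_mem _ c ha

end Quadratic

/-! ## The operads of the statement -/

section Examples

variable (K : Type u) [Field K]

/-- The space of generators spanned by `p` operations without symmetry (the basis vectors
`(i, 0)`) and their opposites (the basis vectors `(i, 1)`). -/
abbrev NonSym (p : ℕ) : Type u := Fin p × Fin 2 → K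

/-- The exchange of each operation with its opposite. -/
def opp (p : ℕ) : NonSym K p →ₗ[K] NonSym K p :=
  LinearMap.funLeft K K (fun x => (x.1, x.2 + 1))

theorem opp_opp (p : ℕ) (μ : NonSym K p) : opp K p (opp K p μ) = μ := by
  funext ⟨i, s⟩
  have h : s + 1 + 1 = s := by revert s; decide
  simp [opp, LinearMap.funLeft, h]

/-- The `i`-th operation without symmetry. -/
def nsOp {p : ℕ} (i : Fin p) : NonSym K p := Pi.single (i, 0) 1

/-- The associator `(x · y) · z - x · (y · z)`. -/
def associator : Ternary K (NonSym K 1) :=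
  leftComb (nsOp K 0) (nsOp K 0) - rightComb (opp K 1) (nsOp K 0) (nsOp K 0)

/-- Associative algebras. -/
abbrev AssOp : QuadData K := .ofRelators (NonSym K 1) (opp K 1) (opp_opp K 1) {associator K}

/-- Commutative and associative algebras: one operation fixed by the exchange of the inputs. -/
abbrev ComOp : QuadData K := .ofRelators K LinearMap.id (fun _ => rfl)
  {leftComb 1 1 - rightComb LinearMap.id 1 1}

/-- Right pre-Lie algebras: the associator is symmetric in the last two arguments. -/
abbrev PreLieOp : QuadData K := .ofRelators (NonSym K 1) (opp K 1) (opp_opp K 1)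
  {associator K - permAct (opp K 1) (Equiv.swap 1 2) (associator K)}

/-- Right Zinbiel algebras: `(x ⋆ y) ⋆ z = x ⋆ (y ⋆ z + z ⋆ y)`. -/
abbrev ZinbOp : QuadData K := .ofRelators (NonSym K 1) (opp K 1) (opp_opp K 1)
  {leftComb (nsOp K 0) (nsOp K 0) -
    rightComb (opp K 1) (nsOp K 0) (nsOp K 0 + opp K 1 (nsOp K 0))}

/-- The product `≺`, the first of two operations without symmetry. -/
def precOp : NonSym K 2 := nsOp K 0

/-- The product `≻`, the second of two operations without symmetry. -/
def succOp : NonSym K 2 := nsOp K 1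

/-- Dendriform algebras:
`(x ≺ y) ≺ z = x ≺ (y ≺ z + y ≻ z)`, `(x ≻ y) ≺ z = x ≻ (y ≺ z)`,
`(x ≺ y + x ≻ y) ≻ z = x ≻ (y ≻ z)`. -/
abbrev DendOp : QuadData K := .ofRelators (NonSym K 2) (opp K 2) (opp_opp K 2)
  {leftComb (precOp K) (precOp K) - rightComb (opp K 2) (precOp K) (precOp K + succOp K),
   leftComb (succOp K) (precOp K) - rightComb (opp K 2) (succOp K) (precOp K),
   leftComb (precOp K + succOp K) (succOp K) - rightComb (opp K 2) (succOp K) (succOp K)}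

/-- The operation `x · y = x ≺ y - y ≻ x`. -/
def dotOp : NonSym K 2 := precOp K - opp K 2 (succOp K)

/-- `L`-dendriform algebras: with `x · y = x ≺ y - y ≻ x`,
`x ≺ (y · z - z · y) = (x ≺ y) ≺ z - (x ≺ z) ≺ y` and
`(x ≻ y) ≺ z = x ≻ (y · z) + (x ≺ z + x ≻ z) ≻ y`. -/
abbrev LDendOp : QuadData K := .ofRelators (NonSym K 2) (opp K 2) (opp_opp K 2)
  {rightComb (opp K 2) (precOp K) (dotOp K - opp K 2 (dotOp K)) -
      (leftComb (precOp K) (precOp K) -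
        permAct (opp K 2) (Equiv.swap 1 2) (leftComb (precOp K) (precOp K))),
   leftComb (succOp K) (precOp K) -
      (rightComb (opp K 2) (succOp K) (dotOp K) +
        permAct (opp K 2) (Equiv.swap 1 2) (leftComb (precOp K + succOp K) (succOp K)))}

end Examples

/-! ## Algebras, differential graded algebras and cochains on the interval -/

section Algebras

variable {K : Type u} [Field K]

/-- The value at `(x₀, x₁, x₂)` of a formal ternary operation, when the generators act on `V`
by `op`. -/
def evalTernary {E : Type u} [AddCommGroup E] [Module K E] {V : Type v} [AddCommGroup V]
    [Module K V] (op : E →ₗ[K] V →ₗ[K] V →ₗ[K] V) (x : Fin 3 → V) : Ternary K E →ₗ[K] V :=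
  ∑ i : Fin 3, TensorProduct.lift
    (LinearMap.mk₂ K (fun μ ν => op μ (op ν (x (i + 1)) (x (i + 2))) (x i))
      (by intros; simp) (by intros; simp) (by intros; simp) (by intros; simp)) ∘ₗ
      LinearMap.proj i

/-- An algebra structure on `V` over the binary quadratic operad `P(E, R)`. -/
@[ext]
structure Alg (D : QuadData K) (V : Type v) [AddCommGroup V] [Module K V] where
  op : D.E →ₗ[K] V →ₗ[K] V →ₗ[K] V
  op_τ : ∀ μ x y, op (D.τ μ) x y = op μ y x
  rel : ∀ r ∈ D.R, ∀ x : Fin 3 → V, evalTernary op x r = 0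

/-- A dg algebra structure over `P(E, R)` on a cochain complex `d : C⁰ → C¹` concentrated in the
degrees `0` and `1`. Since a product of two elements of degree one vanishes, the Koszul signs of
the symmetries and of the relations, which only appear when two elements of degree one are
exchanged, play no role, and the Leibniz rule only has content for two elements of degree zero. -/
@[ext]
structure DGAlg (D : QuadData K) {C₀ C₁ : Type v} [AddCommGroup C₀] [Module K C₀]
    [AddCommGroup C₁] [Module K C₁] (d : C₀ →ₗ[K] C₁) extends Alg D (C₀ × C₁) where
  deg_zero_zero : ∀ μ a b, (op μ (a, 0) (b, 0)).2 = 0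
  deg_zero_one : ∀ μ a t, (op μ (a, 0) (0, t)).1 = 0
  deg_one_zero : ∀ μ s b, (op μ (0, s) (b, 0)).1 = 0
  deg_one_one : ∀ μ s t, op μ (0, s) (0, t) = 0
  leibniz : ∀ μ a b,
    d (op μ (a, 0) (b, 0)).1 = (op μ (0, d a) (b, 0)).2 + (op μ (a, 0) (0, d b)).2

variable (K) (V : Type v) [AddCommGroup V] [Module K V]

/-- The differential `C⁰(Δ₁; V) = V^{vertices} → C¹(Δ₁; V) = V` of the complex of non-degenerate
cochains on the interval, with left vertex `0` and right vertex `1`. -/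
def cochainD : (Fin 2 → V) →ₗ[K] V :=
  (LinearMap.proj 1 : (Fin 2 → V) →ₗ[K] V) - (LinearMap.proj 0 : (Fin 2 → V) →ₗ[K] V)

variable {V}

/-- The `0`-cochain with value `x` on the left vertex and `0` on the right vertex. -/
def atLeft (x : V) : (Fin 2 → V) × V := (Pi.single 0 x, 0)

/-- The `0`-cochain with value `0` on the left vertex and `x` on the right vertex. -/
def atRight (x : V) : (Fin 2 → V) × V := (Pi.single 1 x, 0)

/-- The `1`-cochain with value `x` on the edge. -/
def onEdge (x : V) : (Fin 2 → V) × V := (0, x)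

variable {K} (V)

/-- The locality assumption: for each set `X` of vertices the relative cochains, that is the
cochains which vanish on `X`, form an ideal of `C^*(Δ₁; V)`. -/
def IsLocal {D : QuadData K} (A : DGAlg D (cochainD K V)) : Prop :=
  ∀ (X : Set (Fin 2)) (μ : D.E) (a b : (Fin 2 → V) × V), (∀ i ∈ X, a.1 i = 0) →
    (∀ i ∈ X, (A.op μ a b).1 i = 0) ∧ (∀ i ∈ X, (A.op μ b a).1 i = 0)

/-- `Ass_•(O)`-algebra structures on `V`: local dg `O`-algebra structures on `C^*(Δ₁; V)`. -/
abbrev AssBullet (D : QuadData K) : Type _ :=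
  {A : DGAlg D (cochainD K V) // IsLocal V A}

/-- `Com_•(O)`-algebra structures on `V`: the `Ass_•(O)`-algebra structures for which the
associated `O`-algebra structure on `V`, that is the product of `0`-cochains on the right vertex,
is trivial. -/
abbrev ComBullet (D : QuadData K) : Type _ :=
  {A : AssBullet V D // ∀ (μ : D.E) (x y : V), A.1.op μ (atRight x) (atRight y) = 0}

/-- `preLie_•(O)`-algebra structures on `V`: dg `O`-algebra structures on the complex
`C^*(Δ₁, v_l; V)` of cochains relative to the left vertex, which is `id : V → V`, where the
first `V` is the value on the right vertex and the second one is the value on the edge. -/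
abbrev PreLieBullet (D : QuadData K) : Type _ :=
  DGAlg D (LinearMap.id : V →ₗ[K] V)

end Algebras

end Operads

end

open Operads

noncomputable section

namespace Operads

/-! ## Morphisms of operads -/

/-! Black products. Renaming generators acts on formal expressions and respects the congruence
`Rel`. Hence an equivariant isomorphism of generators that matches the spaces of relators induces an
isomorphism of operads (`QuadData.operadIso`), and only arity three has to be examined. The map `Ψ`
commutes with `S₃` up to the sign character, so the black product of operads with single relators
`r` and `s` has its relators spanned by the permutations of the elements `Ψ(r ⊗ ρ s)`, with `r`
fixed (`nonempty_iso_black`). The pre-Lie relator changes sign under `(1 2)`, so only `ρ = 1, (0 1),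
(0 2)` matter (`forall_permAct_preLieRelator_mem`). Each isomorphism thus comes down to three
explicit elements, computed on the three tree types. With `μ` the pre-Lie product, the generators
are identified by `μ ⊗ μ ↦ ≺` and `μ ⊗ μᵒᵖ ↦ -≻`, and the twist by the sign forces the other two
values (`splitEquiv`). For `Com` a single product remains (`signEquiv`).

Cochains. Locality makes the products of left and right `0`-cochains vanish. The Leibniz rule for
such a product then identifies left·edge with edge·right and right·edge with edge·left. Applied at a
single vertex, it expresses the product of `0`-cochains as `x ≺ y - y ≻ x`. So the two products on
`V` determine the whole structure (`op_eq_intervalMul`), and the pre-Lie identity evaluated on one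
left, one edge and one right cochain, in three orders, is exactly the dendriform axioms. A trivial
product at the right vertex means `x ≺ y = y ≻ x`, and then the three axioms collapse to the Zinbiel
identity. Relative to the left vertex the differential is the identity, so Leibniz again determines
the product of `0`-cochains (`op_eq_relMul`), and the pre-Lie identity with one edge cochain is the
pair of `L`-dendriform axioms. -/

/-- A morphism of operads. -/
structure SymOperad.Hom {K : Type u} [Field K] (P : SymOperad.{u, v} K) (Q : SymOperad.{u, w} K)
    where
  toLin : ∀ (X : Type) [Finite X], P.obj X →ₗ[K] Q.obj X
  toLin_map : ∀ {X Y : Type} [Finite X] [Finite Y] (e : X ≃ Y) (a : P.obj X),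
    toLin Y (P.map e a) = Q.map e (toLin X a)
  toLin_one : toLin Unit P.one = Q.one
  toLin_comp : ∀ {X Y : Type} [Finite X] [Finite Y] (a : P.obj (Option X)) (b : P.obj Y),
    toLin (X ⊕ Y) (P.comp a b) = Q.comp (toLin (Option X) a) (toLin Y b)

section Hom

variable {K : Type u} [Field K] {P : SymOperad.{u, v} K} {Q : SymOperad.{u, w} K}

/-- A pair of mutually inverse morphisms of operads is an isomorphism. -/
def SymOperad.Hom.toIso (f : P.Hom Q) (g : Q.Hom P)
    (hgf : ∀ (X : Type) [Finite X] (a : P.obj X), g.toLin X (f.toLin X a) = a)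
    (hfg : ∀ (X : Type) [Finite X] (a : Q.obj X), f.toLin X (g.toLin X a) = a) :
    SymOperad.Iso P Q where
  equiv X _ := LinearEquiv.ofLinearMap (f.toLin X) (g.toLin X)
    (LinearMap.ext (hfg X)) (LinearMap.ext (hgf X))
  equiv_map := f.toLin_map
  equiv_one := f.toLin_one
  equiv_comp := f.toLin_comp

/-- A morphism which takes the generators of an ideal into another ideal takes the whole ideal
into it. -/
theorem SymOperad.Hom.mem_ideal (f : P.Hom Q) {S : Set (P.obj (Fin 3))} {T : Set (Q.obj (Fin 3))}
    (h : ∀ s ∈ S, f.toLin (Fin 3) s ∈ ideal Q T (Fin 3)) (X : Type) [Finite X] (a : P.obj X)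
    (ha : a ∈ ideal P S X) : f.toLin X a ∈ ideal Q T X := by
  change InIdeal P S X a at ha
  induction ha with
  | of hr => exact h _ hr
  | zero X => rw [map_zero]; exact zero_mem _
  | add _ _ iha ihb => rw [map_add]; exact add_mem iha ihb
  | smul c _ ih => rw [map_smul]; exact Submodule.smul_mem _ c ih
  | map e _ ih => rw [f.toLin_map]; exact InIdeal.map e ih
  | comp_left b _ ih => rw [f.toLin_comp]; exact InIdeal.comp_left _ ih
  | comp_right a _ ih => rw [f.toLin_comp]; exact InIdeal.comp_right _ ih

/-- The morphism induced between quotients. -/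
def SymOperad.Hom.quotient (f : P.Hom Q) {S : Set (P.obj (Fin 3))} {T : Set (Q.obj (Fin 3))}
    (h : ∀ s ∈ S, f.toLin (Fin 3) s ∈ ideal Q T (Fin 3)) :
    (quotientOperad P S).Hom (quotientOperad Q T) where
  toLin X _ := (ideal P S X).mapQ (ideal Q T X) (f.toLin X) (f.mem_ideal h X)
  toLin_map {X Y} _ _ e a := by
    obtain ⟨a, rfl⟩ := Submodule.Quotient.mk_surjective _ a
    exact congrArg (Submodule.Quotient.mk (p := ideal Q T Y)) (f.toLin_map e a)
  toLin_one := congrArg (Submodule.Quotient.mk (p := ideal Q T Unit)) f.toLin_one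
  toLin_comp {X Y} _ _ a b := by
    obtain ⟨a, rfl⟩ := Submodule.Quotient.mk_surjective _ a
    obtain ⟨b, rfl⟩ := Submodule.Quotient.mk_surjective _ b
    exact congrArg (Submodule.Quotient.mk (p := ideal Q T (X ⊕ Y))) (f.toLin_comp a b)

end Hom

/-! ## Functoriality of the free operad and of binary quadratic operads -/

/-- The replacement of the generators of a formal expression. -/
def Pre.mapGen {K E F : Type u} (φ : E → F) : {X : Type} → Pre K E X → Pre K F X
  | _, .gen μ => .gen (φ μ)
  | _, .one => .one
  | _, @Pre.zero _ _ X _ => .zero X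
  | _, @Pre.add _ _ _ _ a b => .add (a.mapGen φ) (b.mapGen φ)
  | _, @Pre.smul _ _ _ _ c a => .smul c (a.mapGen φ)
  | _, @Pre.map _ _ _ _ _ _ e a => .map e (a.mapGen φ)
  | _, @Pre.comp _ _ _ _ _ _ a b => .comp (a.mapGen φ) (b.mapGen φ)

/-- The equality holds between expressions themselves, not merely up to `Rel`, so mutually inverse
maps of generators give mutually inverse morphisms of free operads. -/
theorem Pre.mapGen_mapGen {K E F : Type u} {φ : E → F} {ψ : F → E} (h : ∀ μ, ψ (φ μ) = μ) {X : Type}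
    (a : Pre K E X) : (a.mapGen φ).mapGen ψ = a := by
  induction a with
  | gen μ => simp only [Pre.mapGen, h]
  | one => rfl
  | zero X => rfl
  | add a b iha ihb => simp only [Pre.mapGen, iha, ihb]
  | smul c a ih => simp only [Pre.mapGen, ih]
  | map e a ih => simp only [Pre.mapGen, ih]
  | comp a b iha ihb => simp only [Pre.mapGen, iha, ihb]

section Functoriality

variable {K : Type u} [Field K] {E F : Type u} [AddCommGroup E] [Module K E] [AddCommGroup F]
  [Module K F] {τ : E →ₗ[K] E} {τ' : F →ₗ[K] F}

/-- Every rule of the congruence is uniform in its arguments. Only `gen_add`, `gen_smul` and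
`gen_swap` see the generators; they use the linearity of `φ` and its compatibility with the exchange
of inputs. -/
theorem Rel.mapGen (φ : E →ₗ[K] F) (hφ : ∀ μ, φ (τ μ) = τ' (φ μ)) {X : Type} {a b : Pre K E X}
    (h : Rel K E τ a b) : Rel K F τ' (a.mapGen φ) (b.mapGen φ) := by
  induction h with
  | refl a => exact Rel.refl _
  | symm _ ih => exact Rel.symm ih
  | trans _ _ ih ih' => exact Rel.trans ih ih'
  | add _ _ ih ih' => exact Rel.add ih ih'
  | smul c _ ih => exact Rel.smul c ih
  | map e _ ih => exact Rel.map e ih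
  | comp _ _ ih ih' => exact Rel.comp ih ih'
  | add_comm a b => exact Rel.add_comm _ _
  | add_assoc a b c => exact Rel.add_assoc _ _ _
  | zero_add a => exact Rel.zero_add _
  | zero_smul a => exact Rel.zero_smul _
  | smul_zero c => exact Rel.smul_zero _
  | one_smul a => exact Rel.one_smul _
  | mul_smul c d a => exact Rel.mul_smul _ _ _
  | add_smul c d a => exact Rel.add_smul _ _ _
  | smul_add c a b => exact Rel.smul_add _ _ _
  | map_add e a b => exact Rel.map_add _ _ _
  | map_smul e c a => exact Rel.map_smul _ _ _
  | comp_add_left a a' b => exact Rel.comp_add_left _ _ _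
  | comp_smul_left c a b => exact Rel.comp_smul_left _ _ _
  | comp_add_right a b b' => exact Rel.comp_add_right _ _ _
  | comp_smul_right c a b => exact Rel.comp_smul_right _ _ _
  | map_refl a => exact Rel.map_refl _
  | map_trans e f a => exact Rel.map_trans _ _ _
  | comp_map e f a b => exact Rel.comp_map _ _ _ _
  | comp_one a => exact Rel.comp_one _
  | one_comp b => exact Rel.one_comp _
  | comp_seq a b c => exact Rel.comp_seq _ _ _
  | comp_par a b c => exact Rel.comp_par _ _ _
  | gen_add μ ν => simp only [Pre.mapGen, _root_.map_add]; exact Rel.gen_add _ _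
  | gen_smul c μ => simp only [Pre.mapGen, _root_.map_smul]; exact Rel.gen_smul _ _
  | gen_swap μ => simp only [Pre.mapGen, hφ]; exact Rel.gen_swap _

/-- The morphism of free operads induced by a map of generators. -/
def freeHom (φ : E →ₗ[K] F) (hφ : ∀ μ, φ (τ μ) = τ' (φ μ)) :
    (freeOperad τ).Hom (freeOperad τ') where
  toLin X _ :=
    { toFun := Quotient.map (Pre.mapGen φ) (fun _ _ h => Rel.mapGen φ hφ h)
      map_add' := by rintro ⟨a⟩ ⟨b⟩; rfl
      map_smul' := by rintro c ⟨a⟩; rfl }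
  toLin_map := by rintro X Y _ _ e ⟨a⟩; rfl
  toLin_one := rfl
  toLin_comp := by rintro X Y _ _ ⟨a⟩ ⟨b⟩; rfl

theorem freeHom_freeHom (φ : E →ₗ[K] F) (hφ : ∀ μ, φ (τ μ) = τ' (φ μ)) (ψ : F →ₗ[K] E)
    (hψ : ∀ μ, ψ (τ' μ) = τ (ψ μ)) (h : ∀ μ, ψ (φ μ) = μ) (X : Type) [Finite X]
    (a : (freeOperad τ).obj X) : (freeHom ψ hψ).toLin X ((freeHom φ hφ).toLin X a) = a := by
  obtain ⟨a⟩ := a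
  exact congrArg (FreeObj.mk τ) (Pre.mapGen_mapGen h a)

/-- The map of ternary operations induced by a map of generators. -/
def ternaryMap (φ : E →ₗ[K] F) : Ternary K E →ₗ[K] Ternary K F :=
  LinearMap.pi fun i => TensorProduct.map φ φ ∘ₗ LinearMap.proj i

theorem ternaryMap_apply (φ : E →ₗ[K] F) (r : Ternary K E) (i : Fin 3) :
    ternaryMap φ r i = TensorProduct.map φ φ (r i) := rfl

/-- Renaming generators commutes by definition with relabelling and composition, so on pure tensors
both sides are the same expression. This carries relators of one presentation to relators of
another. -/
theorem freeHom_ternaryVal (φ : E →ₗ[K] F) (hφ : ∀ μ, φ (τ μ) = τ' (φ μ)) (r : Ternary K E) :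
    (freeHom φ hφ).toLin (Fin 3) (ternaryVal (freeOperad τ) (freeGen τ) r) =
      ternaryVal (freeOperad τ') (freeGen τ') (ternaryMap φ r) := by
  simp only [ternaryVal, LinearMap.sum_apply, map_sum, LinearMap.comp_apply, LinearMap.proj_apply,
    ternaryMap_apply]
  refine Finset.sum_congr rfl fun i _ => ?_
  generalize r i = t
  induction t using TensorProduct.induction_on with
  | zero => simp only [map_zero]
  | add a b ha hb => simp only [map_add, ha, hb]
  | tmul a b => rfl

/-- An isomorphism of quadratic data induces an isomorphism of operads. -/
def QuadData.operadIso {D D' : QuadData K} (φ : D.E ≃ₗ[K] D'.E) (hφ : ∀ μ, φ (D.τ μ) = D'.τ (φ μ))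
    (h : ∀ r ∈ D.R, ternaryMap φ.toLinearMap r ∈ D'.R)
    (h' : ∀ r ∈ D'.R, ternaryMap φ.symm.toLinearMap r ∈ D.R) :
    SymOperad.Iso D.operad D'.operad :=
  have hψ : ∀ μ, φ.symm (D'.τ μ) = D.τ (φ.symm μ) := fun μ => by
    rw [LinearEquiv.symm_apply_eq, hφ, LinearEquiv.apply_symm_apply]
  SymOperad.Hom.toIso
    ((freeHom φ.toLinearMap hφ).quotient (by
      rintro _ ⟨r, hr, rfl⟩
      rw [freeHom_ternaryVal]
      exact InIdeal.of ⟨_, h r hr, rfl⟩))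
    ((freeHom φ.symm.toLinearMap hψ).quotient (by
      rintro _ ⟨r, hr, rfl⟩
      rw [freeHom_ternaryVal]
      exact InIdeal.of ⟨_, h' r hr, rfl⟩))
    (fun X _ a => by
      obtain ⟨a, rfl⟩ := Submodule.Quotient.mk_surjective _ a
      exact congrArg Submodule.Quotient.mk
        (freeHom_freeHom φ.toLinearMap hφ φ.symm.toLinearMap hψ φ.symm_apply_apply X a))
    (fun X _ a => by
      obtain ⟨a, rfl⟩ := Submodule.Quotient.mk_surjective _ a
      exact congrArg Submodule.Quotient.mk
        (freeHom_freeHom φ.symm.toLinearMap hψ φ.toLinearMap hφ φ.apply_symm_apply X a))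

/-! ## Isomorphisms from a Manin black product -/

theorem ternaryMap_permAct (φ : E →ₗ[K] F) (hφ : ∀ μ, φ (τ μ) = τ' (φ μ))
    (σ : Equiv.Perm (Fin 3)) (r : Ternary K E) :
    ternaryMap φ (permAct τ σ r) = permAct τ' σ (ternaryMap φ r) := by
  funext j
  have key : ∀ t : E ⊗[K] E, TensorProduct.map φ φ (TensorProduct.map LinearMap.id τ t) =
      TensorProduct.map LinearMap.id τ' (TensorProduct.map φ φ t) := by
    intro t
    induction t using TensorProduct.induction_on with
    | zero => simp only [map_zero]
    | add a b ha hb => simp only [map_add, ha, hb]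
    | tmul a b => simp [hφ]
  rcases Int.units_eq_one_or (Equiv.Perm.sign σ) with hs | hs <;>
    simp [permAct, ternaryMap, hs, key]

theorem ternaryMap_ternaryMap (φ : E →ₗ[K] F) (ψ : F →ₗ[K] E) (h : ∀ μ, ψ (φ μ) = μ)
    (r : Ternary K E) : ternaryMap ψ (ternaryMap φ r) = r := by
  funext i
  have h' : ψ ∘ₗ φ = LinearMap.id := LinearMap.ext h
  rw [ternaryMap_apply, ternaryMap_apply, ← LinearMap.comp_apply, ← TensorProduct.map_comp, h',
    TensorProduct.map_id, LinearMap.id_apply]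

/-- `blackMap` as a bilinear map. -/
def blackMapLin : Ternary K E →ₗ[K] Ternary K F →ₗ[K] Ternary K (E ⊗[K] F) :=
  LinearMap.mk₂ K blackMap
    (fun r r' s => by funext i; simp [blackMap, TensorProduct.add_tmul])
    (fun c r s => by
      funext i
      simp only [blackMap, Pi.smul_apply, ← TensorProduct.smul_tmul', map_smul])
    (fun r s s' => by funext i; simp [blackMap, TensorProduct.tmul_add])
    (fun c r s => by funext i; simp [blackMap])

/-- Since `Ψ` is equivariant up to sign, a permutation of the first relator can be pulled out, at
the cost of changing the permutation of the second one. -/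
theorem blackMap_permAct_left (hτ' : ∀ μ, τ' (τ' μ) = μ)
    (σ ρ : Equiv.Perm (Fin 3)) (r : Ternary K E) (s : Ternary K F) :
    blackMap (permAct τ σ r) (permAct τ' ρ s) = (Equiv.Perm.sign σ : ℤ) •
      permAct (-(TensorProduct.map τ τ')) σ (blackMap r (permAct τ' (σ⁻¹ * ρ) s)) := by
  rw [permAct_blackMap, permAct_mul τ' hτ', mul_inv_cancel_left, smul_smul]
  rcases Int.units_eq_one_or (Equiv.Perm.sign σ) with hs | hs <;> simp [hs]

/-- A criterion for the black product of two operads given by single relators `r` and `s` to be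
isomorphic to the operad with relators `T`. -/
theorem nonempty_iso_black [FiniteDimensional K E] [FiniteDimensional K F]
    {G : Type u} [AddCommGroup G] [Module K G] [FiniteDimensional K G] {τ'' : G →ₗ[K] G}
    (hτ : ∀ μ, τ (τ μ) = μ) (hτ' : ∀ μ, τ' (τ' μ) = μ) (hτ'' : ∀ μ, τ'' (τ'' μ) = μ)
    (r : Ternary K E) (s : Ternary K F) (T : Set (Ternary K G))
    (φ : E ⊗[K] F ≃ₗ[K] G) (hφ : ∀ μ ν, φ (τ μ ⊗ₜ τ' ν) = -τ'' (φ (μ ⊗ₜ ν)))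
    (h : ∀ ρ, ternaryMap φ.toLinearMap (blackMap r (permAct τ' ρ s)) ∈
      (QuadData.ofRelators G τ'' hτ'' T).R)
    (h' : ∀ t ∈ T, ∃ ρ, ternaryMap φ.toLinearMap (blackMap r (permAct τ' ρ s)) = t ∨
      ternaryMap φ.toLinearMap (blackMap r (permAct τ' ρ s)) = -t) :
    Nonempty (SymOperad.Iso (black (QuadData.ofRelators E τ hτ {r})
      (QuadData.ofRelators F τ' hτ' {s})).operad (QuadData.ofRelators G τ'' hτ'' T).operad) := by
  set D := black (QuadData.ofRelators E τ hτ {r}) (QuadData.ofRelators F τ' hτ' {s})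
  have hφ' : ∀ μ, φ.toLinearMap (-(TensorProduct.map τ τ') μ) = τ'' (φ.toLinearMap μ) := by
    intro μ
    induction μ using TensorProduct.induction_on with
    | zero => simp only [map_zero, neg_zero]
    | add a b ha hb => simp only [map_add, neg_add, ha, hb]
    | tmul a b => simp [hφ]
  refine ⟨QuadData.operadIso (D := D) φ hφ' ?_ ?_⟩
  · intro q hq
    induction hq using Submodule.span_induction with
    | zero => rw [map_zero]; exact zero_mem _
    | add a b _ _ ha hb => rw [map_add]; exact add_mem ha hb
    | smul c a _ ha => rw [map_smul]; exact Submodule.smul_mem _ c ha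
    | mem q hq =>
      obtain ⟨a, ha, b, hb, rfl⟩ := hq
      change ternaryMap φ.toLinearMap (blackMapLin a b) ∈ _
      induction ha using Submodule.span_induction with
      | zero => simp only [map_zero, LinearMap.zero_apply]; exact zero_mem _
      | add a a' _ _ ha hb =>
        simp only [map_add, LinearMap.add_apply]; exact add_mem ha hb
      | smul c a _ ha =>
        simp only [map_smul, LinearMap.smul_apply]; exact Submodule.smul_mem _ c ha
      | mem a ha =>
        obtain ⟨σ, _, rfl, rfl⟩ := ha
        induction hb using Submodule.span_induction with
        | zero => simp only [map_zero]; exact zero_mem _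
        | add a a' _ _ ha hb => simp only [map_add]; exact add_mem ha hb
        | smul c a _ ha => simp only [map_smul]; exact Submodule.smul_mem _ c ha
        | mem b hb =>
          obtain ⟨ρ, _, rfl, rfl⟩ := hb
          change ternaryMap φ.toLinearMap (blackMap _ _) ∈ _
          -- Both relators are permuted here; the first permutation goes outside, where the
          -- stability of the target relators under `S₃` absorbs it.
          rw [blackMap_permAct_left hτ', map_zsmul, ternaryMap_permAct _ hφ']
          exact zsmul_mem ((QuadData.ofRelators G τ'' hτ'' T).R_stable _ _ (h _)) _
  · intro q hq
    induction hq using Submodule.span_induction with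
    | zero => rw [map_zero]; exact zero_mem _
    | add a b _ _ ha hb => rw [map_add]; exact add_mem ha hb
    | smul c a _ ha => rw [map_smul]; exact Submodule.smul_mem _ c ha
    | mem q hq =>
      obtain ⟨σ, t, ht, rfl⟩ := hq
      -- By equivariance of the inverse of `φ`, only the unpermuted relator `t` has to be pulled
      -- back.
      rw [ternaryMap_permAct (τ' := D.τ) φ.symm.toLinearMap (fun μ => by
        change φ.symm _ = _
        rw [LinearEquiv.symm_apply_eq]
        exact ((hφ' _).trans (congrArg τ'' (φ.apply_symm_apply μ))).symm)]
      refine D.R_stable σ _ ?_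
      have hr : ∀ ρ, blackMap r (permAct τ' ρ s) ∈ D.R := fun ρ =>
        Submodule.subset_span ⟨r, Submodule.subset_span ⟨1, r, rfl, by funext j; simp [permAct]⟩,
          _, Submodule.subset_span ⟨ρ, s, rfl, rfl⟩, rfl⟩
      have hinv := ternaryMap_ternaryMap φ.toLinearMap φ.symm.toLinearMap φ.symm_apply_apply
      obtain ⟨ρ, hρ | hρ⟩ := h' t ht
      · rw [← hρ, hinv]
        exact hr ρ
      · rw [← neg_neg t, ← hρ, map_neg, hinv]
        exact neg_mem (hr ρ)

end Functoriality

/-! ## The black products with the operad of pre-Lie algebras -/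

section BlackProducts

variable (K : Type u) [Field K]

/-! ### The pre-Lie relator and its permutations, by tree type. -/

theorem permAct_swap {K : Type u} [Field K] {E : Type u} [AddCommGroup E] [Module K E]
    (τ : E →ₗ[K] E) {a b : Fin 3} (hab : a ≠ b) (r : Ternary K E) (j : Fin 3) :
    permAct τ (Equiv.swap a b) r j =
      TensorProduct.map LinearMap.id τ (r (Equiv.swap a b j)) := by
  simp [permAct, Equiv.Perm.sign_swap hab]

theorem permAct_one {K : Type u} [Field K] {E : Type u} [AddCommGroup E] [Module K E]
    (τ : E →ₗ[K] E) (r : Ternary K E) : permAct τ 1 r = r := by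
  funext j; simp [permAct]

theorem associator_eq :
    associator K = ![-(opp K 1 (nsOp K 0) ⊗ₜ nsOp K 0), 0, nsOp K 0 ⊗ₜ nsOp K 0] := by
  funext i
  fin_cases i <;> simp [associator, leftComb, rightComb]

/-- The relator of pre-Lie algebras. -/
def preLieRelator : Ternary K (NonSym K 1) :=
  associator K - permAct (opp K 1) (Equiv.swap 1 2) (associator K)

/-- Both monomials with `x₀` outside fall in component `0`. In component `1` the inner inputs come
in the cyclic order `(x₂, x₀)`, so `(x₀ · x₂) · x₁` is written with the opposite inner product. -/
theorem preLieRelator_eq : preLieRelator K =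
    ![opp K 1 (nsOp K 0) ⊗ₜ (opp K 1 (nsOp K 0) - nsOp K 0), -(nsOp K 0 ⊗ₜ opp K 1 (nsOp K 0)),
      nsOp K 0 ⊗ₜ nsOp K 0] := by
  funext i
  rw [preLieRelator, Pi.sub_apply, permAct_swap _ (by decide), associator_eq]
  fin_cases i <;> simp [Equiv.swap_apply_def, TensorProduct.tmul_sub]
  abel

theorem permAct_swap_zero_one_preLieRelator :
    permAct (opp K 1) (Equiv.swap 0 1) (preLieRelator K) =
      ![-(nsOp K 0 ⊗ₜ nsOp K 0), opp K 1 (nsOp K 0) ⊗ₜ (nsOp K 0 - opp K 1 (nsOp K 0)),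
        nsOp K 0 ⊗ₜ opp K 1 (nsOp K 0)] := by
  funext i
  rw [permAct_swap _ (by decide), preLieRelator_eq]
  fin_cases i <;> simp [Equiv.swap_apply_def, opp_opp]

theorem permAct_swap_zero_two_preLieRelator :
    permAct (opp K 1) (Equiv.swap 0 2) (preLieRelator K) =
      ![nsOp K 0 ⊗ₜ opp K 1 (nsOp K 0), -(nsOp K 0 ⊗ₜ nsOp K 0),
        opp K 1 (nsOp K 0) ⊗ₜ (nsOp K 0 - opp K 1 (nsOp K 0))] := by
  funext i
  rw [permAct_swap _ (by decide), preLieRelator_eq]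
  fin_cases i <;> simp [Equiv.swap_apply_def, opp_opp]

/-- The relator is the associator minus its image under the involution `(1 2)`. -/
theorem permAct_swap_one_two_preLieRelator :
    permAct (opp K 1) (Equiv.swap 1 2) (preLieRelator K) = -preLieRelator K := by
  rw [preLieRelator, map_sub, permAct_mul _ (opp_opp K 1), Equiv.swap_mul_self, permAct_one,
    neg_sub]

/-- The permutations of the pre-Lie relator are, up to sign, those by `1`, `(0 1)`, `(0 2)`. -/
theorem forall_permAct_preLieRelator_mem {K : Type u} [Field K] {M : Type u} [AddCommGroup M]
    [Module K M] (f : Ternary K (NonSym K 1) →ₗ[K] M) (N : Submodule K M)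
    (h : f (preLieRelator K) ∈ N)
    (h₁ : f (permAct (opp K 1) (Equiv.swap 0 1) (preLieRelator K)) ∈ N)
    (h₂ : f (permAct (opp K 1) (Equiv.swap 0 2) (preLieRelator K)) ∈ N)
    (ρ : Equiv.Perm (Fin 3)) : f (permAct (opp K 1) ρ (preLieRelator K)) ∈ N := by
  have key : ∀ σ, f (permAct (opp K 1) σ (preLieRelator K)) ∈ N →
      f (permAct (opp K 1) (σ * Equiv.swap 1 2) (preLieRelator K)) ∈ N := by
    intro σ hσ
    rw [← permAct_mul _ (opp_opp K 1), permAct_swap_one_two_preLieRelator, map_neg, map_neg]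
    exact neg_mem hσ
  have h₀ : f (permAct (opp K 1) 1 (preLieRelator K)) ∈ N := by
    rwa [permAct_one]
  -- The elements `1`, `(0 1)`, `(0 2)` represent the left cosets of the subgroup generated by `(1
  -- 2)`.
  have hρ : ρ = 1 ∨ ρ = Equiv.swap 0 1 ∨ ρ = Equiv.swap 0 2 ∨ ρ = 1 * Equiv.swap 1 2 ∨
      ρ = Equiv.swap 0 1 * Equiv.swap 1 2 ∨ ρ = Equiv.swap 0 2 * Equiv.swap 1 2 := by
    revert ρ; decide
  rcases hρ with rfl | rfl | rfl | rfl | rfl | rfl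
  exacts [h₀, h₁, h₂, key _ h₀, key _ h₁, key _ h₂]

/-! ### Bases of the generators and the identification `E ⊗ F ⊗ sgn ≅ G`. -/

theorem opp_apply {p : ℕ} (μ : NonSym K p) (x : Fin p × Fin 2) :
    opp K p μ x = μ (x.1, x.2 + 1) := rfl

theorem nsOp_apply {p : ℕ} (i : Fin p) (x : Fin p × Fin 2) :
    nsOp K i x = if x = (i, 0) then 1 else 0 := Pi.single_apply _ _ _

theorem nonSym_one_eq (μ : NonSym K 1) :
    μ = μ (0, 0) • nsOp K 0 + μ (0, 1) • opp K 1 (nsOp K 0) := by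
  funext ⟨i, s⟩
  fin_cases i; fin_cases s <;> simp [opp_apply, nsOp_apply]

theorem nonSym_two_eq (μ : NonSym K 2) :
    μ = μ (0, 0) • precOp K + μ (0, 1) • opp K 2 (precOp K) + μ (1, 0) • succOp K +
      μ (1, 1) • opp K 2 (succOp K) := by
  funext ⟨i, s⟩
  fin_cases i <;> fin_cases s <;> simp [opp_apply, nsOp_apply, precOp, succOp]

/-- The identification of the generators of the black product of two operads generated by an
operation without symmetry with two operations without symmetry. -/
def splitEquiv : NonSym K 1 ⊗[K] NonSym K 1 ≃ₗ[K] NonSym K 2 :=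
  LinearEquiv.ofLinearMap
    (TensorProduct.lift (LinearMap.mk₂ K
      -- The minus sign at `≻` is needed for `≺ + ≻`, rather than `≺ - ≻`, to appear in the
      -- dendriform relators. The last two terms are then forced by the sign twist.
      (fun μ ν => (μ (0, 0) * ν (0, 0)) • precOp K - (μ (0, 0) * ν (0, 1)) • succOp K -
        (μ (0, 1) * ν (0, 1)) • opp K 2 (precOp K) + (μ (0, 1) * ν (0, 0)) • opp K 2 (succOp K))
      (fun _ _ _ => by simp only [Pi.add_apply]; module)
      (fun _ _ _ => by simp only [Pi.smul_apply, smul_eq_mul]; module)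
      (fun _ _ _ => by simp only [Pi.add_apply]; module)
      (fun _ _ _ => by simp only [Pi.smul_apply, smul_eq_mul]; module)))
    ((LinearMap.proj (0, 0)).smulRight (nsOp K 0 ⊗ₜ nsOp K 0) -
      (LinearMap.proj (1, 0)).smulRight (nsOp K 0 ⊗ₜ opp K 1 (nsOp K 0)) -
      (LinearMap.proj (0, 1)).smulRight (opp K 1 (nsOp K 0) ⊗ₜ opp K 1 (nsOp K 0)) +
      (LinearMap.proj (1, 1)).smulRight (opp K 1 (nsOp K 0) ⊗ₜ nsOp K 0))
    (by
      refine LinearMap.ext fun μ => ?_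
      conv_rhs => rw [LinearMap.id_apply, nonSym_two_eq K μ]
      simp [opp_apply, nsOp_apply]
      module)
    (by
      refine TensorProduct.ext' fun μ ν => ?_
      conv_rhs => rw [LinearMap.id_apply, nonSym_one_eq K μ, nonSym_one_eq K ν]
      simp only [TensorProduct.add_tmul, TensorProduct.tmul_add, TensorProduct.smul_tmul_smul]
      simp [opp_apply, nsOp_apply, precOp, succOp]
      abel)

theorem splitEquiv_tmul (μ ν : NonSym K 1) : splitEquiv K (μ ⊗ₜ ν) =
    (μ (0, 0) * ν (0, 0)) • precOp K - (μ (0, 0) * ν (0, 1)) • succOp K -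
      (μ (0, 1) * ν (0, 1)) • opp K 2 (precOp K) + (μ (0, 1) * ν (0, 0)) • opp K 2 (succOp K) :=
  rfl

/-- The minus sign is the factor `sgn` in the generators of the black product; this is the
equivariance required by `nonempty_iso_black`. -/
theorem splitEquiv_opp (μ ν : NonSym K 1) :
    splitEquiv K (opp K 1 μ ⊗ₜ opp K 1 ν) = -opp K 2 (splitEquiv K (μ ⊗ₜ ν)) := by
  simp [splitEquiv_tmul, opp_opp, opp_apply]
  abel

theorem splitEquiv_zero_zero : splitEquiv K (nsOp K 0 ⊗ₜ nsOp K 0) = precOp K := by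
  simp [splitEquiv_tmul, nsOp_apply]

theorem splitEquiv_zero_one :
    splitEquiv K (nsOp K 0 ⊗ₜ opp K 1 (nsOp K 0)) = -succOp K := by
  simp [splitEquiv_tmul, nsOp_apply, opp_apply]

theorem splitEquiv_one_zero :
    splitEquiv K (opp K 1 (nsOp K 0) ⊗ₜ nsOp K 0) = opp K 2 (succOp K) := by
  simp [splitEquiv_tmul, nsOp_apply, opp_apply]

theorem splitEquiv_one_one :
    splitEquiv K (opp K 1 (nsOp K 0) ⊗ₜ opp K 1 (nsOp K 0)) = -opp K 2 (precOp K) := by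
  simp [splitEquiv_tmul, nsOp_apply, opp_apply]

theorem mem_ofRelators {K : Type u} [Field K] {E : Type u} [AddCommGroup E] [Module K E]
    [FiniteDimensional K E] {τ : E →ₗ[K] E} {hτ : ∀ μ, τ (τ μ) = μ} {S : Set (Ternary K E)}
    {s : Ternary K E} (hs : s ∈ S) : s ∈ (QuadData.ofRelators E τ hτ S).R :=
  Submodule.subset_span ⟨1, s, hs, (permAct_one τ s).symm⟩

/-- The components of the map `ternaryMap φ (blackMap r s)`. -/
def blackPair {K : Type u} [Field K] {E F G : Type u} [AddCommGroup E]
    [Module K E] [AddCommGroup F] [Module K F] [AddCommGroup G] [Module K G]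
    (φ : E ⊗[K] F →ₗ[K] G) (r : E ⊗[K] E) (s : F ⊗[K] F) : G ⊗[K] G :=
  TensorProduct.map φ φ (TensorProduct.tensorTensorTensorComm K E E F F (r ⊗ₜ s))

/-! ### Bilinear expansion of the components of a black product. -/

section BlackPair

variable {K : Type u} [Field K] {E F G : Type u} [AddCommGroup E]
  [Module K E] [AddCommGroup F] [Module K F] [AddCommGroup G] [Module K G]
  (φ : E ⊗[K] F →ₗ[K] G)

theorem ternaryMap_blackMap_apply (r : Ternary K E) (s : Ternary K F) (i : Fin 3) :
    ternaryMap φ (blackMap r s) i = blackPair φ (r i) (s i) := rfl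

theorem blackPair_tmul (a b : E) (c d : F) :
    blackPair φ (a ⊗ₜ b) (c ⊗ₜ d) = φ (a ⊗ₜ c) ⊗ₜ φ (b ⊗ₜ d) := rfl

theorem blackPair_zero_left (s : F ⊗[K] F) : blackPair φ 0 s = 0 := by
  simp only [blackPair, TensorProduct.zero_tmul, map_zero]

theorem blackPair_neg_left (r : E ⊗[K] E) (s : F ⊗[K] F) :
    blackPair φ (-r) s = -blackPair φ r s := by
  simp only [blackPair, TensorProduct.neg_tmul, map_neg]

theorem blackPair_sub_left (r r' : E ⊗[K] E) (s : F ⊗[K] F) :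
    blackPair φ (r - r') s = blackPair φ r s - blackPair φ r' s := by
  simp only [blackPair, TensorProduct.sub_tmul, map_sub]

theorem blackPair_neg_right (r : E ⊗[K] E) (s : F ⊗[K] F) :
    blackPair φ r (-s) = -blackPair φ r s := by
  simp only [blackPair, TensorProduct.tmul_neg, map_neg]

theorem blackPair_sub_right (r : E ⊗[K] E) (s s' : F ⊗[K] F) :
    blackPair φ r (s - s') = blackPair φ r s - blackPair φ r s' := by
  simp only [blackPair, TensorProduct.tmul_sub, map_sub]

end BlackPair

/-- `Ass ● preLie ≅ Dend`. -/
theorem nonempty_iso_black_ass_preLie :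
    Nonempty (SymOperad.Iso (black (AssOp K) (PreLieOp K)).operad (DendOp K).operad) := by
  -- The associator has no component of type `1`, so only the monomials `(x₀ x₁) x₂` and `x₀ (x₁
  -- x₂)` survive in `e₁`, `e₂` and `e₃`: up to sign, one dendriform axiom for each representative
  -- of `ρ`.
  have e₁ : ternaryMap (splitEquiv K).toLinearMap (blackMap (associator K) (preLieRelator K)) =
      leftComb (precOp K) (precOp K) -
        rightComb (opp K 2) (precOp K) (precOp K + succOp K) := by
    funext i
    rw [ternaryMap_blackMap_apply, associator_eq, preLieRelator_eq]
    fin_cases i <;> simp [leftComb, rightComb, blackPair_tmul, blackPair_zero_left,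
      blackPair_neg_left, blackPair_neg_right, blackPair_sub_right, TensorProduct.neg_tmul,
      TensorProduct.tmul_neg, TensorProduct.tmul_sub, TensorProduct.tmul_add,
      splitEquiv_zero_zero, splitEquiv_zero_one, splitEquiv_one_one]
    abel
  have e₂ : ternaryMap (splitEquiv K).toLinearMap (blackMap (associator K)
      (permAct (opp K 1) (Equiv.swap 0 1) (preLieRelator K))) =
      -(leftComb (succOp K) (precOp K) - rightComb (opp K 2) (succOp K) (precOp K)) := by
    funext i
    rw [ternaryMap_blackMap_apply, associator_eq, permAct_swap_zero_one_preLieRelator]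
    fin_cases i <;> simp [leftComb, rightComb, blackPair_tmul, blackPair_zero_left,
      blackPair_neg_left, blackPair_neg_right, blackPair_sub_right, TensorProduct.tmul_neg,
      TensorProduct.tmul_sub, splitEquiv_zero_zero, splitEquiv_zero_one, splitEquiv_one_zero]
  have e₃ : ternaryMap (splitEquiv K).toLinearMap (blackMap (associator K)
      (permAct (opp K 1) (Equiv.swap 0 2) (preLieRelator K))) =
      -(leftComb (precOp K + succOp K) (succOp K) -
        rightComb (opp K 2) (succOp K) (succOp K)) := by
    funext i
    rw [ternaryMap_blackMap_apply, associator_eq, permAct_swap_zero_two_preLieRelator]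
    fin_cases i <;> simp [leftComb, rightComb, blackPair_tmul, blackPair_zero_left,
      blackPair_neg_left, blackPair_neg_right, blackPair_sub_right, TensorProduct.neg_tmul,
      TensorProduct.tmul_neg, TensorProduct.tmul_sub, TensorProduct.tmul_add,
      splitEquiv_zero_zero, splitEquiv_zero_one, splitEquiv_one_zero]
    abel
  refine nonempty_iso_black (opp_opp K 1) (opp_opp K 1) (opp_opp K 2) (associator K)
    (preLieRelator K) _ (splitEquiv K) (splitEquiv_opp K) ?_ ?_
  · refine forall_permAct_preLieRelator_mem
      (ternaryMap (splitEquiv K).toLinearMap ∘ₗ blackMapLin (associator K)) _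
      (e₁.symm ▸ ?_ : ternaryMap _ _ ∈ _) (e₂.symm ▸ ?_ : ternaryMap _ _ ∈ _)
      (e₃.symm ▸ ?_ : ternaryMap _ _ ∈ _)
    · exact mem_ofRelators (Or.inl rfl)
    · exact neg_mem (mem_ofRelators (Or.inr (Or.inl rfl)))
    · exact neg_mem (mem_ofRelators (Or.inr (Or.inr rfl)))
  · rintro t (rfl | rfl | rfl)
    · exact ⟨1, Or.inl (by rw [permAct_one, e₁])⟩
    · exact ⟨_, Or.inr e₂⟩
    · exact ⟨_, Or.inr e₃⟩

/-- `preLie ● preLie ≅ L-Dend`. -/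
theorem nonempty_iso_black_preLie_preLie :
    Nonempty (SymOperad.Iso (black (PreLieOp K) (PreLieOp K)).operad (LDendOp K).operad) := by
  have e₁ : ternaryMap (splitEquiv K).toLinearMap
      (blackMap (preLieRelator K) (preLieRelator K)) =
      -(rightComb (opp K 2) (precOp K) (dotOp K - opp K 2 (dotOp K)) -
        (leftComb (precOp K) (precOp K) -
          permAct (opp K 2) (Equiv.swap 1 2) (leftComb (precOp K) (precOp K)))) := by
    funext i
    rw [ternaryMap_blackMap_apply, Pi.neg_apply, Pi.sub_apply, Pi.sub_apply,
      permAct_swap _ (by decide), preLieRelator_eq]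
    fin_cases i <;> simp [leftComb, rightComb, blackPair_tmul, blackPair_neg_left,
      blackPair_sub_left, blackPair_neg_right, blackPair_sub_right, dotOp, Equiv.swap_apply_def,
      opp_opp, TensorProduct.neg_tmul, TensorProduct.tmul_neg, TensorProduct.tmul_sub,
      splitEquiv_zero_zero, splitEquiv_zero_one, splitEquiv_one_zero, splitEquiv_one_one]
    abel
  have e₂ : ternaryMap (splitEquiv K).toLinearMap (blackMap (preLieRelator K)
      (permAct (opp K 1) (Equiv.swap 0 1) (preLieRelator K))) =
      -(leftComb (succOp K) (precOp K) - (rightComb (opp K 2) (succOp K) (dotOp K) +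
        permAct (opp K 2) (Equiv.swap 1 2) (leftComb (precOp K + succOp K) (succOp K)))) := by
    funext i
    rw [ternaryMap_blackMap_apply, Pi.neg_apply, Pi.sub_apply, Pi.add_apply,
      permAct_swap_zero_one_preLieRelator, preLieRelator_eq, permAct_swap _ (by decide)]
    fin_cases i <;> simp [leftComb, rightComb, blackPair_tmul, blackPair_neg_left,
      blackPair_sub_left, blackPair_neg_right, blackPair_sub_right, dotOp, Equiv.swap_apply_def,
      TensorProduct.neg_tmul, TensorProduct.tmul_neg, TensorProduct.tmul_sub,
      TensorProduct.tmul_add, splitEquiv_zero_zero, splitEquiv_zero_one, splitEquiv_one_zero,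
      splitEquiv_one_one]
    all_goals abel
  -- The third element is a permutation of the second relator, which is why `L`-dendriform algebras
  -- have two axioms and not three.
  have e₃ : ternaryMap (splitEquiv K).toLinearMap (blackMap (preLieRelator K)
      (permAct (opp K 1) (Equiv.swap 0 2) (preLieRelator K))) =
      permAct (opp K 2) (Equiv.swap 1 2)
        (leftComb (succOp K) (precOp K) - (rightComb (opp K 2) (succOp K) (dotOp K) +
          permAct (opp K 2) (Equiv.swap 1 2) (leftComb (precOp K + succOp K) (succOp K)))) := by
    funext i
    rw [ternaryMap_blackMap_apply, permAct_swap_zero_two_preLieRelator, preLieRelator_eq,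
      permAct_swap _ (by decide), Pi.sub_apply, Pi.add_apply, permAct_swap _ (by decide)]
    fin_cases i <;> simp [leftComb, rightComb, blackPair_tmul, blackPair_neg_left,
      blackPair_sub_left, blackPair_neg_right, blackPair_sub_right, dotOp, Equiv.swap_apply_def,
      opp_opp, TensorProduct.neg_tmul, TensorProduct.tmul_neg, TensorProduct.tmul_sub,
      TensorProduct.tmul_add, splitEquiv_zero_zero, splitEquiv_zero_one, splitEquiv_one_zero,
      splitEquiv_one_one]
    all_goals abel
  refine nonempty_iso_black (opp_opp K 1) (opp_opp K 1) (opp_opp K 2) (preLieRelator K)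
    (preLieRelator K) _ (splitEquiv K) (splitEquiv_opp K) ?_ ?_
  · refine forall_permAct_preLieRelator_mem
      (ternaryMap (splitEquiv K).toLinearMap ∘ₗ blackMapLin (preLieRelator K)) _
      (e₁.symm ▸ ?_ : ternaryMap _ _ ∈ _) (e₂.symm ▸ ?_ : ternaryMap _ _ ∈ _)
      (e₃.symm ▸ ?_ : ternaryMap _ _ ∈ _)
    · exact neg_mem (mem_ofRelators (Or.inl rfl))
    · exact neg_mem (mem_ofRelators (Or.inr rfl))
    · exact (LDendOp K).R_stable _ _ (mem_ofRelators (Or.inr rfl))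
  · rintro t (rfl | rfl)
    · exact ⟨1, Or.inr (by rw [permAct_one, e₁])⟩
    · exact ⟨_, Or.inr e₂⟩

/-- The identification of the generators of `Com ● preLie` with those of `Zinb`. -/
def signEquiv : K ⊗[K] NonSym K 1 ≃ₗ[K] NonSym K 1 :=
  TensorProduct.lid K (NonSym K 1) ≪≫ₗ
    -- The exchange acts trivially on the generator of `Com`, so the sign twist is absorbed by
    -- negating the opposite product.
    LinearEquiv.piCongrRight fun x => if x = (0, 0) then LinearEquiv.refl K K else
      LinearEquiv.neg K

theorem signEquiv_zero (c : K) : signEquiv K (c ⊗ₜ nsOp K 0) = c • nsOp K 0 := by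
  funext ⟨i, s⟩
  fin_cases i; fin_cases s <;> simp [signEquiv, nsOp_apply]

theorem signEquiv_one (c : K) :
    signEquiv K (c ⊗ₜ opp K 1 (nsOp K 0)) = -(c • opp K 1 (nsOp K 0)) := by
  funext ⟨i, s⟩
  fin_cases i; fin_cases s <;> simp [signEquiv, nsOp_apply, opp_apply]

theorem signEquiv_opp (c : K) (μ : NonSym K 1) :
    signEquiv K (c ⊗ₜ opp K 1 μ) = -opp K 1 (signEquiv K (c ⊗ₜ μ)) := by
  funext ⟨i, s⟩
  fin_cases i; fin_cases s <;> simp [signEquiv, opp_apply]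

/-- `Com ● preLie ≅ Zinb`. -/
theorem nonempty_iso_black_com_preLie :
    Nonempty (SymOperad.Iso (black (ComOp K) (PreLieOp K)).operad (ZinbOp K).operad) := by
  have hc : (leftComb 1 1 - rightComb LinearMap.id 1 1 : Ternary K K) =
      ![-(1 ⊗ₜ 1), 0, 1 ⊗ₜ 1] := by
    funext i
    fin_cases i <;> simp [leftComb, rightComb]
  have e₁ : ternaryMap (signEquiv K).toLinearMap
      (blackMap (leftComb 1 1 - rightComb LinearMap.id 1 1) (preLieRelator K)) =
      leftComb (nsOp K 0) (nsOp K 0) -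
        rightComb (opp K 1) (nsOp K 0) (nsOp K 0 + opp K 1 (nsOp K 0)) := by
    funext i
    rw [ternaryMap_blackMap_apply, hc, preLieRelator_eq]
    fin_cases i <;> simp [leftComb, rightComb, blackPair_tmul, blackPair_zero_left,
      blackPair_neg_left, blackPair_neg_right, blackPair_sub_right, TensorProduct.neg_tmul,
      TensorProduct.tmul_neg, TensorProduct.tmul_sub, TensorProduct.tmul_add, signEquiv_zero,
      signEquiv_one]
    abel
  -- This element encodes `(x₁ ⋆ x₂) ⋆ x₀ = (x₁ ⋆ x₀) ⋆ x₂`: the two Zinbiel relators for these left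
  -- sides have the same right side, which cancels in the difference.
  have e₂ : ternaryMap (signEquiv K).toLinearMap
      (blackMap (leftComb 1 1 - rightComb LinearMap.id 1 1)
        (permAct (opp K 1) (Equiv.swap 0 1) (preLieRelator K))) =
      permAct (opp K 1) (finRotate 3) (leftComb (nsOp K 0) (nsOp K 0) -
        rightComb (opp K 1) (nsOp K 0) (nsOp K 0 + opp K 1 (nsOp K 0))) -
      permAct (opp K 1) (Equiv.swap 0 1) (leftComb (nsOp K 0) (nsOp K 0) -
        rightComb (opp K 1) (nsOp K 0) (nsOp K 0 + opp K 1 (nsOp K 0))) := by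
    have hr : ∀ (r : Ternary K (NonSym K 1)) (i : Fin 3),
        permAct (opp K 1) (finRotate 3) r i = r (i - 1) := by
      intro r i
      simp [permAct]
    funext i
    rw [ternaryMap_blackMap_apply, hc, permAct_swap_zero_one_preLieRelator, Pi.sub_apply, hr,
      permAct_swap _ (by decide)]
    fin_cases i <;> simp [leftComb, rightComb, blackPair_tmul, blackPair_zero_left,
      blackPair_neg_left, blackPair_neg_right, blackPair_sub_right, TensorProduct.tmul_neg,
      TensorProduct.tmul_sub, TensorProduct.tmul_add, signEquiv_zero, signEquiv_one,
      Equiv.swap_apply_def, opp_opp]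
    all_goals abel
  have e₃ : ternaryMap (signEquiv K).toLinearMap
      (blackMap (leftComb 1 1 - rightComb LinearMap.id 1 1)
        (permAct (opp K 1) (Equiv.swap 0 2) (preLieRelator K))) =
      permAct (opp K 1) (Equiv.swap 0 2) (leftComb (nsOp K 0) (nsOp K 0) -
        rightComb (opp K 1) (nsOp K 0) (nsOp K 0 + opp K 1 (nsOp K 0))) := by
    funext i
    rw [ternaryMap_blackMap_apply, hc, permAct_swap_zero_two_preLieRelator,
      permAct_swap _ (by decide)]
    fin_cases i <;> simp [leftComb, rightComb, blackPair_tmul, blackPair_zero_left,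
      blackPair_neg_left, blackPair_neg_right, blackPair_sub_right, TensorProduct.neg_tmul,
      TensorProduct.tmul_neg, TensorProduct.tmul_sub, TensorProduct.tmul_add, signEquiv_zero,
      signEquiv_one, Equiv.swap_apply_def, opp_opp]
    all_goals abel
  refine nonempty_iso_black (fun _ => rfl) (opp_opp K 1) (opp_opp K 1) _
    (preLieRelator K) _ (signEquiv K) (signEquiv_opp K) ?_ ?_
  · have hm := mem_ofRelators (τ := opp K 1) (hτ := opp_opp K 1)
      (Set.mem_singleton (leftComb (nsOp K 0) (nsOp K 0) -
        rightComb (opp K 1) (nsOp K 0) (nsOp K 0 + opp K 1 (nsOp K 0))))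
    refine forall_permAct_preLieRelator_mem
      (ternaryMap (signEquiv K).toLinearMap ∘ₗ blackMapLin _) _
      (e₁.symm ▸ hm : ternaryMap _ _ ∈ _) (e₂.symm ▸ ?_ : ternaryMap _ _ ∈ _)
      (e₃.symm ▸ ?_ : ternaryMap _ _ ∈ _)
    · exact sub_mem ((ZinbOp K).R_stable _ _ hm) ((ZinbOp K).R_stable _ _ hm)
    · exact (ZinbOp K).R_stable _ _ hm
  · rintro t rfl
    exact ⟨1, Or.inl (by rw [permAct_one, e₁])⟩

end BlackProducts

/-! ## Algebras over binary quadratic operads -/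

section Eval

variable {K : Type u} [Field K] {V : Type v} [AddCommGroup V] [Module K V]

/-! ### Evaluation of ternary operations in an algebra. -/

section Generators

variable {E : Type u} [AddCommGroup E] [Module K E] {τ : E →ₗ[K] E}
  (op : E →ₗ[K] V →ₗ[K] V →ₗ[K] V) (x : Fin 3 → V)

theorem evalTernary_single (i : Fin 3) (μ ν : E) :
    evalTernary op x (Pi.single i (μ ⊗ₜ ν)) = op μ (op ν (x (i + 1)) (x (i + 2))) (x i) := by
  rw [evalTernary, LinearMap.sum_apply, Finset.sum_eq_single i]
  · simp
  · intro j _ hj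
    simp [Pi.single_eq_of_ne hj]
  · simp

theorem evalTernary_leftComb (μ ν : E) :
    evalTernary op x (leftComb μ ν) = op ν (op μ (x 0) (x 1)) (x 2) :=
  evalTernary_single op x 2 ν μ

theorem evalTernary_rightComb (hop : ∀ μ x y, op (τ μ) x y = op μ y x) (μ ν : E) :
    evalTernary op x (rightComb τ μ ν) = op μ (x 0) (op ν (x 1) (x 2)) :=
  (evalTernary_single op x 0 (τ μ) ν).trans (hop _ _ _)

/-- It suffices to treat one monomial. An even permutation preserves the cyclic order of the inputs;
an odd one reverses it, and `τ` on the inner operation compensates. Relators therefore need to be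
checked only before permutation. -/
theorem evalTernary_permAct (hop : ∀ μ x y, op (τ μ) x y = op μ y x)
    (σ : Equiv.Perm (Fin 3)) (r : Ternary K E) :
    evalTernary op x (permAct τ σ r) = evalTernary op (x ∘ σ) r := by
  suffices h : evalTernary op x ∘ₗ permAct τ σ = evalTernary op (x ∘ σ) from
    LinearMap.congr_fun h r
  refine LinearMap.pi_ext' fun i => TensorProduct.ext' fun μ ν => ?_
  simp only [LinearMap.comp_apply, LinearMap.single_apply, evalTernary_single, Function.comp_apply]
  have hsingle : permAct τ σ (Pi.single i (μ ⊗ₜ ν)) =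
      Pi.single (σ i) (if Equiv.Perm.sign σ = 1 then μ ⊗ₜ ν else μ ⊗ₜ τ ν) := by
    funext j
    by_cases hj : j = σ i
    · subst hj
      by_cases hs : Equiv.Perm.sign σ = 1 <;> simp [permAct, hs]
    · have hj' : σ⁻¹ j ≠ i := fun h => hj (by rw [← h]; simp)
      rw [Pi.single_eq_of_ne hj]
      simp only [permAct, LinearMap.pi_apply, LinearMap.comp_apply, LinearMap.proj_apply,
        Pi.single_eq_of_ne hj', map_zero]
  have h₀ : ∀ (σ : Equiv.Perm (Fin 3)) (i : Fin 3), Equiv.Perm.sign σ = 1 →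
      σ i + 1 = σ (i + 1) ∧ σ i + 2 = σ (i + 2) := by decide
  have h₁ : ∀ (σ : Equiv.Perm (Fin 3)) (i : Fin 3), ¬Equiv.Perm.sign σ = 1 →
      σ i + 1 = σ (i + 2) ∧ σ i + 2 = σ (i + 1) := by decide
  rw [hsingle]
  by_cases hs : Equiv.Perm.sign σ = 1
  · have h := h₀ σ i hs
    rw [if_pos hs, evalTernary_single, h.1, h.2]
  · have h := h₁ σ i hs
    rw [if_neg hs, evalTernary_single, h.1, h.2, hop]

/-- An algebra over the operad given by the relators `S` is an action of the generators which
satisfies these relators. -/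
def Alg.ofRelators [FiniteDimensional K E] (hτ : ∀ μ, τ (τ μ) = μ) (S : Set (Ternary K E))
    (hop : ∀ μ x y, op (τ μ) x y = op μ y x) (h : ∀ s ∈ S, ∀ x, evalTernary op x s = 0) :
    Alg (QuadData.ofRelators E τ hτ S) V where
  op := op
  op_τ := hop
  rel r hr x := by
    induction hr using Submodule.span_induction with
    | mem r hr =>
      obtain ⟨σ, s, hs, rfl⟩ := hr
      rw [evalTernary_permAct op x hop, h s hs]
    | zero => rw [map_zero]
    | add a b _ _ ha hb => rw [map_add, ha, hb, add_zero]
    | smul c a _ ha => rw [map_smul, ha, smul_zero]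

theorem Alg.rel_relator [FiniteDimensional K E] {hτ : ∀ μ, τ (τ μ) = μ} {S : Set (Ternary K E)}
    (A : Alg (QuadData.ofRelators E τ hτ S) V) {s : Ternary K E} (hs : s ∈ S) (x : Fin 3 → V) :
    evalTernary A.op x s = 0 :=
  A.rel s (mem_ofRelators hs) x

end Generators

/-- The action of the operations without symmetry and of their opposites by bilinear maps. -/
def nonSymAct {p : ℕ} (m : Fin p → V →ₗ[K] V →ₗ[K] V) :
    NonSym K p →ₗ[K] V →ₗ[K] V →ₗ[K] V :=
  ∑ i, ((LinearMap.proj (i, 0)).smulRight (m i) + (LinearMap.proj (i, 1)).smulRight (m i).flip)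

theorem nonSymAct_apply {p : ℕ} (m : Fin p → V →ₗ[K] V →ₗ[K] V) (μ : NonSym K p) (x y : V) :
    nonSymAct m μ x y = ∑ i, (μ (i, 0) • m i x y + μ (i, 1) • m i y x) := by
  simp [nonSymAct]

theorem nonSymAct_opp {p : ℕ} (m : Fin p → V →ₗ[K] V →ₗ[K] V) (μ : NonSym K p) (x y : V) :
    nonSymAct m (opp K p μ) x y = nonSymAct m μ y x := by
  simp [nonSymAct_apply, opp_apply, add_comm]

theorem nonSymAct_nsOp {p : ℕ} (m : Fin p → V →ₗ[K] V →ₗ[K] V) (i : Fin p) :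
    nonSymAct m (nsOp K i) = m i := by
  refine LinearMap.ext₂ fun x y => ?_
  simp [nonSymAct_apply, nsOp_apply]

/-- The operations `nsOp K i` and their opposites form the standard basis of `NonSym K p`, and `hop`
fixes the values on the opposites. -/
theorem eq_nonSymAct {p : ℕ} (op : NonSym K p →ₗ[K] V →ₗ[K] V →ₗ[K] V)
    (hop : ∀ μ x y, op (opp K p μ) x y = op μ y x) :
    op = nonSymAct fun i => op (nsOp K i) := by
  refine LinearMap.pi_ext' fun ⟨i, s⟩ => LinearMap.ext_ring (LinearMap.ext₂ fun x y => ?_)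
  have h₀ : (Pi.single (i, 0) 1 : NonSym K p) = nsOp K i := rfl
  have h₁ : (Pi.single (i, 1) 1 : NonSym K p) = opp K p (nsOp K i) := by
    funext ⟨j, t⟩
    fin_cases t <;> simp [opp_apply, nsOp_apply, Pi.single_apply]
  simp only [LinearMap.comp_apply, LinearMap.single_apply]
  fin_cases s
  · change op (Pi.single (i, 0) 1) x y = nonSymAct _ (Pi.single (i, 0) 1) x y
    rw [h₀, nonSymAct_nsOp]
  · change op (Pi.single (i, 1) 1) x y = nonSymAct _ (Pi.single (i, 1) 1) x y
    rw [h₁, nonSymAct_opp, nonSymAct_nsOp, hop]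

/-- The action of operations without symmetry is determined by these operations. -/
theorem nonSym_op_ext {p : ℕ} {op op' : NonSym K p →ₗ[K] V →ₗ[K] V →ₗ[K] V}
    (hop : ∀ μ x y, op (opp K p μ) x y = op μ y x)
    (hop' : ∀ μ x y, op' (opp K p μ) x y = op' μ y x)
    (h : ∀ i, op (nsOp K i) = op' (nsOp K i)) : op = op' := by
  rw [eq_nonSymAct op hop, eq_nonSymAct op' hop', funext h]

/-! ### The relators as identities between products. -/

/-- The identity of right pre-Lie algebras. -/
def IsPreLie (m : V →ₗ[K] V →ₗ[K] V) : Prop :=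
  ∀ x y z, m (m x y) z - m x (m y z) = m (m x z) y - m x (m z y)

/-- The identities of dendriform algebras. -/
structure IsDend (p s : V →ₗ[K] V →ₗ[K] V) : Prop where
  prec_prec : ∀ x y z, p (p x y) z = p x (p y z) + p x (s y z)
  succ_prec : ∀ x y z, p (s x y) z = s x (p y z)
  succ_succ : ∀ x y z, s (p x y) z + s (s x y) z = s x (s y z)

/-- The identities of `L`-dendriform algebras. -/
structure IsLDend (p s : V →ₗ[K] V →ₗ[K] V) : Prop where
  prec_bracket : ∀ x y z, p x (p y z) - p x (s z y) - p x (p z y) + p x (s y z) =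
    p (p x y) z - p (p x z) y
  succ_prec : ∀ x y z, p (s x y) z = s x (p y z) - s x (s z y) + s (p x z) y + s (s x z) y

theorem cons_fin_three {V : Type v} (x y z : V) :
    (![x, y, z] : Fin 3 → V) 0 = x ∧ (![x, y, z] : Fin 3 → V) 1 = y ∧
      (![x, y, z] : Fin 3 → V) 2 = z := ⟨rfl, rfl, rfl⟩

theorem evalTernary_preLie (op : NonSym K 1 →ₗ[K] V →ₗ[K] V →ₗ[K] V)
    (hop : ∀ μ x y, op (opp K 1 μ) x y = op μ y x) :
    (∀ s ∈ ({associator K - permAct (opp K 1) (Equiv.swap 1 2) (associator K)} :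
      Set (Ternary K (NonSym K 1))), ∀ x, evalTernary op x s = 0) ↔ IsPreLie (op (nsOp K 0)) := by
  have key : ∀ x, evalTernary op x
      (associator K - permAct (opp K 1) (Equiv.swap 1 2) (associator K)) =
      op (nsOp K 0) (op (nsOp K 0) (x 0) (x 1)) (x 2) -
        op (nsOp K 0) (x 0) (op (nsOp K 0) (x 1) (x 2)) -
      (op (nsOp K 0) (op (nsOp K 0) (x 0) (x 2)) (x 1) -
        op (nsOp K 0) (x 0) (op (nsOp K 0) (x 2) (x 1))) := by
    intro x
    rw [map_sub, evalTernary_permAct op x hop, associator, map_sub, map_sub,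
      evalTernary_leftComb, evalTernary_leftComb, evalTernary_rightComb op _ hop,
      evalTernary_rightComb op _ hop]
    rfl
  simp only [Set.mem_singleton_iff, forall_eq, key, sub_eq_zero]
  exact ⟨fun h x y z => h ![x, y, z], fun h x => h _ _ _⟩

theorem evalTernary_dend (op : NonSym K 2 →ₗ[K] V →ₗ[K] V →ₗ[K] V)
    (hop : ∀ μ x y, op (opp K 2 μ) x y = op μ y x) :
    (∀ s ∈ ({leftComb (precOp K) (precOp K) -
          rightComb (opp K 2) (precOp K) (precOp K + succOp K),
        leftComb (succOp K) (precOp K) - rightComb (opp K 2) (succOp K) (precOp K),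
        leftComb (precOp K + succOp K) (succOp K) -
          rightComb (opp K 2) (succOp K) (succOp K)} :
      Set (Ternary K (NonSym K 2))), ∀ x, evalTernary op x s = 0) ↔
      IsDend (op (precOp K)) (op (succOp K)) := by
  simp only [Set.mem_insert_iff, Set.mem_singleton_iff, forall_eq_or_imp, forall_eq, map_sub,
    evalTernary_leftComb, evalTernary_rightComb op _ hop, sub_eq_zero, map_add,
    LinearMap.add_apply]
  exact ⟨fun h => ⟨fun x y z => h.1 ![x, y, z], fun x y z => h.2.1 ![x, y, z],
    fun x y z => h.2.2 ![x, y, z]⟩, fun h => ⟨fun x => h.1 _ _ _, fun x => h.2 _ _ _,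
    fun x => h.3 _ _ _⟩⟩

theorem evalTernary_lDend (op : NonSym K 2 →ₗ[K] V →ₗ[K] V →ₗ[K] V)
    (hop : ∀ μ x y, op (opp K 2 μ) x y = op μ y x) :
    (∀ s ∈ ({rightComb (opp K 2) (precOp K) (dotOp K - opp K 2 (dotOp K)) -
          (leftComb (precOp K) (precOp K) -
            permAct (opp K 2) (Equiv.swap 1 2) (leftComb (precOp K) (precOp K))),
        leftComb (succOp K) (precOp K) - (rightComb (opp K 2) (succOp K) (dotOp K) +
          permAct (opp K 2) (Equiv.swap 1 2) (leftComb (precOp K + succOp K) (succOp K)))} :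
      Set (Ternary K (NonSym K 2))), ∀ x, evalTernary op x s = 0) ↔
      IsLDend (op (precOp K)) (op (succOp K)) := by
  simp only [Set.mem_insert_iff, Set.mem_singleton_iff, forall_eq_or_imp, forall_eq, map_sub,
    evalTernary_permAct op _ hop, evalTernary_leftComb, evalTernary_rightComb op _ hop,
    sub_eq_zero, map_add, LinearMap.add_apply, LinearMap.sub_apply, dotOp, hop,
    Function.comp_apply, opp_opp]
  have h₁ : Equiv.swap (1 : Fin 3) 2 0 = 0 := by decide
  simp only [h₁, Equiv.swap_apply_left, Equiv.swap_apply_right]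
  constructor
  · rintro ⟨h, h'⟩
    refine ⟨fun x y z => ?_, fun x y z => ?_⟩
    · have := h ![x, y, z]
      simp only [cons_fin_three] at this
      rw [← this]
      abel
    · have := h' ![x, y, z]
      simp only [cons_fin_three] at this
      rw [this]
      abel
  · rintro ⟨h, h'⟩
    refine ⟨fun x => ?_, fun x => ?_⟩
    · rw [← h]
      abel
    · rw [h']
      abel

/-- When `≻` is the flip of `≺`, the first and third dendriform axioms are both the Zinbiel
identity, up to renaming variables. The second says `(y ⋆ x) ⋆ z = (y ⋆ z) ⋆ x`, which follows
because the right side of the Zinbiel identity is symmetric in its last two arguments. -/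
theorem evalTernary_zinb (op : NonSym K 1 →ₗ[K] V →ₗ[K] V →ₗ[K] V)
    (hop : ∀ μ x y, op (opp K 1 μ) x y = op μ y x) :
    (∀ s ∈ ({leftComb (nsOp K 0) (nsOp K 0) -
        rightComb (opp K 1) (nsOp K 0) (nsOp K 0 + opp K 1 (nsOp K 0))} :
      Set (Ternary K (NonSym K 1))), ∀ x, evalTernary op x s = 0) ↔
      IsDend (op (nsOp K 0)) (op (nsOp K 0)).flip := by
  simp only [Set.mem_singleton_iff, forall_eq, map_sub,
    evalTernary_leftComb, evalTernary_rightComb op _ hop, sub_eq_zero, map_add,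
    LinearMap.add_apply, hop]
  constructor
  · intro h
    have h' : ∀ x y z, op (nsOp K 0) (op (nsOp K 0) x y) z =
        op (nsOp K 0) x (op (nsOp K 0) y z) + op (nsOp K 0) x (op (nsOp K 0) z y) :=
      fun x y z => h ![x, y, z]
    refine ⟨h', fun x y z => ?_, fun x y z => ?_⟩
    · simp only [LinearMap.flip_apply, h']
      abel
    · simp only [LinearMap.flip_apply, h']
      abel
  · exact fun h x => h.prec_prec _ _ _

end Eval

/-! ## Differential graded pre-Lie algebras of cochains -/

section Cochains

variable {K : Type u} [Field K]

/-- A dg pre-Lie algebra structure in the degrees `0` and `1`, from its product. -/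
def DGAlg.ofPreLie {C₀ C₁ : Type v} [AddCommGroup C₀] [Module K C₀] [AddCommGroup C₁]
    [Module K C₁] (d : C₀ →ₗ[K] C₁) (m : C₀ × C₁ →ₗ[K] C₀ × C₁ →ₗ[K] C₀ × C₁) (hm : IsPreLie m)
    (h₀₀ : ∀ a b, (m (a, 0) (b, 0)).2 = 0) (h₀₁ : ∀ a t, (m (a, 0) (0, t)).1 = 0)
    (h₁₀ : ∀ s b, (m (0, s) (b, 0)).1 = 0) (h₁₁ : ∀ s t, m (0, s) (0, t) = 0)
    (hd : ∀ a b, d (m (a, 0) (b, 0)).1 = (m (0, d a) (b, 0)).2 + (m (a, 0) (0, d b)).2) :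
    DGAlg (PreLieOp K) d where
  toAlg := Alg.ofRelators (nonSymAct fun _ => m) (opp_opp K 1) _ (nonSymAct_opp _)
    ((evalTernary_preLie _ (nonSymAct_opp _)).2 (by rwa [nonSymAct_nsOp]))
  deg_zero_zero μ a b := by simp [Alg.ofRelators, nonSymAct_apply, h₀₀]
  -- A generator is a combination of the product and its opposite, so both mixed degrees enter.
  deg_zero_one μ a b := by simp [Alg.ofRelators, nonSymAct_apply, h₀₁, h₁₀]
  deg_one_zero μ a b := by simp [Alg.ofRelators, nonSymAct_apply, h₀₁, h₁₀]
  deg_one_one μ a b := by simp [Alg.ofRelators, nonSymAct_apply, h₁₁]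
  -- For the opposite product the two terms of the Leibniz rule change places, without sign, as both
  -- factors have degree zero.
  leibniz μ a b := by
    simp [Alg.ofRelators, nonSymAct_apply, hd]
    module

theorem DGAlg.isPreLie {C₀ C₁ : Type v} [AddCommGroup C₀] [Module K C₀] [AddCommGroup C₁]
    [Module K C₁] {d : C₀ →ₗ[K] C₁} (A : DGAlg (PreLieOp K) d) : IsPreLie (A.op (nsOp K 0)) :=
  (evalTernary_preLie A.op A.op_τ).1 fun _ hs x => A.rel_relator hs x

theorem DGAlg.preLie_ext {C₀ C₁ : Type v} [AddCommGroup C₀] [Module K C₀] [AddCommGroup C₁]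
    [Module K C₁] {d : C₀ →ₗ[K] C₁} {A B : DGAlg (PreLieOp K) d}
    (h : A.op (nsOp K 0) = B.op (nsOp K 0)) : A = B :=
  DGAlg.ext (nonSym_op_ext A.op_τ B.op_τ fun i => by rw [Subsingleton.elim i 0, h])

/-! ### Cochain products built from two products on `V`. -/

variable {V : Type v} [AddCommGroup V] [Module K V]

/-- The product of cochains on the interval associated with the products `p` and `s`. -/
def intervalMul (p s : V →ₗ[K] V →ₗ[K] V) :
    (Fin 2 → V) × V →ₗ[K] (Fin 2 → V) × V →ₗ[K] (Fin 2 → V) × V :=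
  LinearMap.mk₂ K (fun a b => (fun i => p (a.1 i) (b.1 i) - s (b.1 i) (a.1 i),
      p (a.1 0) b.2 + p a.2 (b.1 1) - s b.2 (a.1 1) - s (b.1 0) a.2))
    (fun a a' b => by
      ext <;> simp only [Prod.fst_add, Prod.snd_add, Pi.add_apply, map_add, LinearMap.add_apply] <;>
        abel)
    (fun c a b => by
      ext <;> simp only [Prod.smul_fst, Prod.smul_snd, Pi.smul_apply, map_smul,
        LinearMap.smul_apply] <;> module)
    (fun a b b' => by
      ext <;> simp only [Prod.fst_add, Prod.snd_add, Pi.add_apply, map_add, LinearMap.add_apply] <;>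
        abel)
    (fun c a b => by
      ext <;> simp only [Prod.smul_fst, Prod.smul_snd, Pi.smul_apply, map_smul,
        LinearMap.smul_apply] <;> module)

theorem intervalMul_apply (p s : V →ₗ[K] V →ₗ[K] V) (a b : (Fin 2 → V) × V) :
    intervalMul p s a b = (fun i => p (a.1 i) (b.1 i) - s (b.1 i) (a.1 i),
      p (a.1 0) b.2 + p a.2 (b.1 1) - s b.2 (a.1 1) - s (b.1 0) a.2) := rfl

/-- The product of cochains on the interval relative to the left vertex associated with the
products `p` and `s`. -/
def relMul (p s : V →ₗ[K] V →ₗ[K] V) : V × V →ₗ[K] V × V →ₗ[K] V × V :=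
  LinearMap.mk₂ K (fun a b => (p a.1 b.1 - s b.1 a.1, p a.2 b.1 - s b.2 a.1))
    (fun a a' b => by
      ext <;> simp only [Prod.fst_add, Prod.snd_add, map_add, LinearMap.add_apply] <;> abel)
    (fun c a b => by
      ext <;> simp only [Prod.smul_fst, Prod.smul_snd, map_smul, LinearMap.smul_apply] <;> module)
    (fun a b b' => by
      ext <;> simp only [Prod.fst_add, Prod.snd_add, map_add, LinearMap.add_apply] <;> abel)
    (fun c a b => by
      ext <;> simp only [Prod.smul_fst, Prod.smul_snd, map_smul, LinearMap.smul_apply] <;> module)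

theorem relMul_apply (p s : V →ₗ[K] V →ₗ[K] V) (a b : V × V) :
    relMul p s a b = (p a.1 b.1 - s b.1 a.1, p a.2 b.1 - s b.2 a.1) := rfl

/-- The vertex components say that `x ≺ y - y ≻ x` is pre-Lie in any dendriform algebra. In all
components the three axioms bring both sides to the same normal form. -/
theorem isPreLie_intervalMul {p s : V →ₗ[K] V →ₗ[K] V} (h : IsDend p s) :
    IsPreLie (intervalMul p s) := by
  rintro ⟨a, e⟩ ⟨b, f⟩ ⟨c, g⟩
  simp only [intervalMul_apply]
  ext
  · simp only [Prod.fst_sub, Pi.sub_apply, map_sub, LinearMap.sub_apply, h.prec_prec, h.succ_prec,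
      ← h.succ_succ]
    abel
  · simp only [Prod.snd_sub, map_sub, map_add, LinearMap.sub_apply, LinearMap.add_apply,
      h.prec_prec, h.succ_prec, ← h.succ_succ]
    abel

/-- Each axiom is the edge component of the pre-Lie identity on one left, one edge and one right
cochain. The products of left with right cochains vanish, so no other terms remain. -/
theorem isDend_of_isPreLie_intervalMul {p s : V →ₗ[K] V →ₗ[K] V}
    (h : IsPreLie (intervalMul p s)) : IsDend p s := by
  refine ⟨fun x y z => ?_, fun x y z => ?_, fun x y z => ?_⟩
  · have := congrArg Prod.snd (h (atLeft x) (onEdge y) (atRight z))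
    simp [intervalMul_apply, atLeft, onEdge, atRight] at this
    rw [← sub_eq_zero] at this ⊢
    rw [← this]
    abel
  · have := congrArg Prod.snd (h (onEdge y) (atLeft x) (atRight z))
    simp [intervalMul_apply, atLeft, onEdge, atRight] at this
    exact this
  · have := congrArg Prod.snd (h (atRight z) (onEdge y) (atLeft x))
    simp [intervalMul_apply, atLeft, onEdge, atRight] at this
    rw [← this, sub_add_cancel]

/-- The two degrees have formally the same product, so the same combination of one instance of
`prec_bracket` and two of `succ_prec` proves both components. -/
theorem isPreLie_relMul {p s : V →ₗ[K] V →ₗ[K] V} (h : IsLDend p s) :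
    IsPreLie (relMul p s) := by
  rintro ⟨a, e⟩ ⟨b, f⟩ ⟨c, g⟩
  simp only [relMul_apply]
  ext
  · have h₁ := h.prec_bracket a b c
    have h₂ := h.succ_prec b a c
    have h₃ := h.succ_prec c a b
    simp only [Prod.fst_sub, map_sub, LinearMap.sub_apply]
    linear_combination (norm := module) h₃ - h₂ - h₁
  · have h₁ := h.prec_bracket e b c
    have h₂ := h.succ_prec f a c
    have h₃ := h.succ_prec g a b
    simp only [Prod.snd_sub, map_sub, LinearMap.sub_apply]
    linear_combination (norm := module) h₃ - h₂ - h₁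

/-- The two axioms are the edge components of the pre-Lie identity with the edge cochain in first,
respectively second, position. -/
theorem isLDend_of_isPreLie_relMul {p s : V →ₗ[K] V →ₗ[K] V} (h : IsPreLie (relMul p s)) :
    IsLDend p s := by
  refine ⟨fun x y z => ?_, fun x y z => ?_⟩
  · have := congrArg Prod.snd (h (0, x) (y, 0) (z, 0))
    simp [relMul_apply] at this
    linear_combination (norm := module) -this
  · have := congrArg Prod.snd (h (y, 0) (0, x) (z, 0))
    simp [relMul_apply] at this
    linear_combination (norm := module) -this

end Cochains

/-! ## The equivalences between dg pre-Lie structures on cochains and algebra structures -/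

section Equivalences

variable {K : Type u} [Field K] {V : Type v} [AddCommGroup V] [Module K V]

/-- The product `≺` on `V` associated with a dg algebra structure on the cochains. -/
def cochainPrec (A : DGAlg (PreLieOp K) (cochainD K V)) : V →ₗ[K] V →ₗ[K] V :=
  ((A.op (nsOp K 0)).compl₁₂ (LinearMap.inl K _ V ∘ₗ LinearMap.single K (fun _ => V) 0)
    (LinearMap.inr K (Fin 2 → V) V)).compr₂ (LinearMap.snd K _ V)

/-- The product `≻` on `V` associated with a dg algebra structure on the cochains. -/
def cochainSucc (A : DGAlg (PreLieOp K) (cochainD K V)) : V →ₗ[K] V →ₗ[K] V :=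
  -(((A.op (nsOp K 0)).compl₁₂ (LinearMap.inr K (Fin 2 → V) V)
    (LinearMap.inl K _ V ∘ₗ LinearMap.single K (fun _ => V) 0)).compr₂ (LinearMap.snd K _ V)).flip

theorem cochainPrec_apply (A : DGAlg (PreLieOp K) (cochainD K V)) (x y : V) :
    cochainPrec A x y = (A.op (nsOp K 0) (atLeft x) (onEdge y)).2 := rfl

theorem cochainSucc_apply (A : DGAlg (PreLieOp K) (cochainD K V)) (x y : V) :
    cochainSucc A x y = -(A.op (nsOp K 0) (onEdge y) (atLeft x)).2 := rfl

theorem cochain_eq (a : (Fin 2 → V) × V) :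
    a = atLeft (a.1 0) + atRight (a.1 1) + onEdge a.2 := by
  refine Prod.ext (funext fun i => ?_) ?_
  · fin_cases i <;> simp [atLeft, atRight, onEdge]
  · simp [atLeft, atRight, onEdge]

theorem cochainD_apply (f : Fin 2 → V) : cochainD K V f = f 1 - f 0 := rfl

theorem onEdge_neg (x : V) : onEdge (-x) = -onEdge x := by simp [onEdge]

/-- A local dg pre-Lie structure on the cochains is determined by the two products on `V`. -/
theorem op_eq_intervalMul (A : DGAlg (PreLieOp K) (cochainD K V)) (hA : IsLocal V A) :
    A.op (nsOp K 0) = intervalMul (cochainPrec A) (cochainSucc A) := by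
  set m := A.op (nsOp K 0)
  -- A left cochain vanishes on the right vertex, so by locality its products with anything vanish
  -- there; `locR` is the mirror statement.
  have locL : ∀ x b, (m (atLeft x) b).1 1 = 0 ∧ (m b (atLeft x)).1 1 = 0 := fun x b => by
    have h := hA {1} (nsOp K 0) (atLeft x) b (by simp [atLeft])
    exact ⟨h.1 1 rfl, h.2 1 rfl⟩
  have locR : ∀ x b, (m (atRight x) b).1 0 = 0 ∧ (m b (atRight x)).1 0 = 0 := fun x b => by
    have h := hA {0} (nsOp K 0) (atRight x) b (by simp [atRight])
    exact ⟨h.1 0 rfl, h.2 0 rfl⟩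
  have dL : ∀ x : V, cochainD K V (Pi.single 0 x) = -x := fun x => by simp [cochainD_apply]
  have dR : ∀ x : V, cochainD K V (Pi.single 1 x) = x := fun x => by simp [cochainD_apply]
  have hLe : ∀ x t, m (atLeft x) (onEdge t) = onEdge (cochainPrec A x t) := fun x t =>
    Prod.ext (A.deg_zero_one _ _ _) rfl
  have heL : ∀ t x, m (onEdge t) (atLeft x) = onEdge (-cochainSucc A x t) := fun t x =>
    Prod.ext (A.deg_one_zero _ _ _) (by rw [cochainSucc_apply, neg_neg]; rfl)
  have hee : ∀ t u, m (onEdge t) (onEdge u) = 0 := A.deg_one_one _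
  -- The `0`-cochain left·right is zero at both vertices, so the Leibniz rule gives `0 =
  -- -(edge·right) + left·edge`. The sign comes from `dL`. The same argument for right·left gives
  -- `hRe`.
  have heR : ∀ t y, m (onEdge t) (atRight y) = onEdge (cochainPrec A t y) := fun t y => by
    refine Prod.ext (A.deg_one_zero _ _ _) ?_
    have h := A.leibniz (nsOp K 0) (Pi.single 0 t) (Pi.single 1 y)
    rw [cochainD_apply, dL, dR] at h
    change (m (atLeft t) (atRight y)).1 1 - (m (atLeft t) (atRight y)).1 0 =
      (m (onEdge (-t)) (atRight y)).2 + (m (atLeft t) (onEdge y)).2 at h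
    rw [(locL _ _).1, (locR _ _).2, onEdge_neg, map_neg, LinearMap.neg_apply, Prod.snd_neg,
      sub_zero, hLe] at h
    exact (neg_add_eq_zero.1 h.symm)
  have hRe : ∀ x t, m (atRight x) (onEdge t) = onEdge (-cochainSucc A t x) := fun x t => by
    refine Prod.ext (A.deg_zero_one _ _ _) ?_
    have h := A.leibniz (nsOp K 0) (Pi.single 1 x) (Pi.single 0 t)
    rw [cochainD_apply, dL, dR] at h
    change (m (atRight x) (atLeft t)).1 1 - (m (atRight x) (atLeft t)).1 0 =
      (m (onEdge x) (atLeft t)).2 + (m (atRight x) (onEdge (-t))).2 at h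
    rw [(locL _ _).2, (locR _ _).1, onEdge_neg, map_neg, Prod.snd_neg,
      sub_zero, heL] at h
    exact (add_neg_eq_zero.1 h.symm).symm
  -- The value at the left vertex is minus the differential, since the value at the right vertex is
  -- zero; the Leibniz rule computes that differential from the two edge products.
  have hLL : ∀ x y, m (atLeft x) (atLeft y) =
      atLeft (cochainPrec A x y - cochainSucc A y x) := fun x y => by
    have h := A.leibniz (nsOp K 0) (Pi.single 0 x) (Pi.single 0 y)
    rw [cochainD_apply, dL, dL] at h
    change (m (atLeft x) (atLeft y)).1 1 - (m (atLeft x) (atLeft y)).1 0 =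
      (m (onEdge (-x)) (atLeft y)).2 + (m (atLeft x) (onEdge (-y))).2 at h
    rw [(locL _ _).2, onEdge_neg, onEdge_neg, map_neg, map_neg, LinearMap.neg_apply, hLe, heL] at h
    refine Prod.ext (funext fun i => ?_) (A.deg_zero_zero _ _ _)
    fin_cases i
    · rw [← neg_inj]
      simpa [onEdge, atLeft, sub_eq_add_neg] using h
    · simpa [atLeft] using (locL x (atLeft y)).1
  have hRR : ∀ x y, m (atRight x) (atRight y) =
      atRight (cochainPrec A x y - cochainSucc A y x) := fun x y => by
    have h := A.leibniz (nsOp K 0) (Pi.single 1 x) (Pi.single 1 y)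
    rw [cochainD_apply, dR, dR] at h
    change (m (atRight x) (atRight y)).1 1 - (m (atRight x) (atRight y)).1 0 =
      (m (onEdge x) (atRight y)).2 + (m (atRight x) (onEdge y)).2 at h
    rw [(locR _ _).2, hRe, heR] at h
    refine Prod.ext (funext fun i => ?_) (A.deg_zero_zero _ _ _)
    fin_cases i
    · simpa [atRight] using (locR x (atRight y)).1
    · simpa [onEdge, atRight, sub_eq_add_neg] using h
  -- One factor vanishes on each vertex, so the product vanishes on both and, having degree zero, is
  -- zero.
  have hLR : ∀ x y, m (atLeft x) (atRight y) = 0 := fun x y => by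
    refine Prod.ext (funext fun i => ?_) (A.deg_zero_zero _ _ _)
    fin_cases i
    exacts [(locR _ _).2, (locL _ _).1]
  have hRL : ∀ x y, m (atRight x) (atLeft y) = 0 := fun x y => by
    refine Prod.ext (funext fun i => ?_) (A.deg_zero_zero _ _ _)
    fin_cases i
    exacts [(locR _ _).1, (locL _ _).2]
  refine LinearMap.ext₂ fun a b => ?_
  conv_lhs => rw [cochain_eq a, cochain_eq b]
  simp only [map_add, LinearMap.add_apply, hLL, hLR, hLe, hRL, hRR, hRe, heL, heR, hee]
  refine Prod.ext (funext fun i => ?_) ?_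
  · fin_cases i <;> simp [intervalMul_apply, atLeft, atRight, onEdge]
  · simp [intervalMul_apply, atLeft, atRight, onEdge]
    abel

/-- The local dg pre-Lie structure on the cochains associated with a dendriform structure. -/
def intervalDGAlg (p s : V →ₗ[K] V →ₗ[K] V) (h : IsDend p s) :
    DGAlg (PreLieOp K) (cochainD K V) :=
  DGAlg.ofPreLie _ (intervalMul p s) (isPreLie_intervalMul h)
    (fun a b => by simp [intervalMul_apply])
    (fun a b => by funext i; simp [intervalMul_apply])
    (fun a b => by funext i; simp [intervalMul_apply])
    (fun a b => Prod.ext (by funext i; simp [intervalMul_apply]) (by simp [intervalMul_apply]))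
    (fun a b => by
      simp [intervalMul_apply, cochainD_apply]
      abel)

theorem intervalDGAlg_op (p s : V →ₗ[K] V →ₗ[K] V) (h : IsDend p s) :
    (intervalDGAlg p s h).op (nsOp K 0) = intervalMul p s :=
  nonSymAct_nsOp _ _

theorem isLocal_intervalDGAlg (p s : V →ₗ[K] V →ₗ[K] V) (h : IsDend p s) :
    IsLocal V (intervalDGAlg p s h) := by
  intro X μ a b ha
  have key : ∀ c d, (intervalDGAlg p s h).op μ c d =
      μ (0, 0) • intervalMul p s c d + μ (0, 1) • intervalMul p s d c := fun c d =>
    (nonSymAct_apply (fun _ : Fin 1 => intervalMul p s) μ c d).trans (by simp)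
  -- Products of `0`-cochains are computed vertex by vertex, so vanishing at a vertex is inherited.
  constructor <;> intro i hi <;> simp [key, intervalMul_apply, ha i hi]

/-- Local dg pre-Lie structures on the cochains are the same as pairs of products which satisfy
the dendriform identities. -/
def assBulletEquiv : AssBullet V (PreLieOp K) ≃
    {q : (V →ₗ[K] V →ₗ[K] V) × (V →ₗ[K] V →ₗ[K] V) // IsDend q.1 q.2} where
  toFun A := ⟨(cochainPrec A.1, cochainSucc A.1), isDend_of_isPreLie_intervalMul
    (op_eq_intervalMul A.1 A.2 ▸ A.1.isPreLie)⟩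
  invFun q := ⟨intervalDGAlg q.1.1 q.1.2 q.2, isLocal_intervalDGAlg _ _ _⟩
  left_inv A := Subtype.ext (DGAlg.preLie_ext (by
    rw [intervalDGAlg_op, ← op_eq_intervalMul A.1 A.2]))
  right_inv q := by
    refine Subtype.ext (Prod.ext (LinearMap.ext₂ fun x y => ?_) (LinearMap.ext₂ fun x y => ?_))
    · rw [cochainPrec_apply, intervalDGAlg_op]
      simp [intervalMul_apply, atLeft, onEdge]
    · rw [cochainSucc_apply, intervalDGAlg_op]
      simp [intervalMul_apply, atLeft, onEdge]

/-- Dendriform algebras are pairs of products which satisfy the dendriform identities. -/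
def dendEquiv : Alg (DendOp K) V ≃
    {q : (V →ₗ[K] V →ₗ[K] V) × (V →ₗ[K] V →ₗ[K] V) // IsDend q.1 q.2} where
  toFun B := ⟨(B.op (precOp K), B.op (succOp K)),
    (evalTernary_dend B.op B.op_τ).1 fun _ hs x => B.rel_relator hs x⟩
  invFun q := Alg.ofRelators (nonSymAct ![q.1.1, q.1.2]) (opp_opp K 2) _ (nonSymAct_opp _)
    ((evalTernary_dend _ (nonSymAct_opp _)).2 (by
      rw [precOp, succOp, nonSymAct_nsOp, nonSymAct_nsOp]
      exact q.2))
  left_inv B := Alg.ext (nonSym_op_ext (nonSymAct_opp _) B.op_τ fun i => by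
    refine (nonSymAct_nsOp _ i).trans ?_
    fin_cases i <;> rfl)
  right_inv q := Subtype.ext (Prod.ext (nonSymAct_nsOp _ 0) (nonSymAct_nsOp _ 1))

/-- Zinbiel algebras are dendriform algebras with `x ≺ y = y ≻ x`. -/
def zinbEquiv : Alg (ZinbOp K) V ≃
    {q : {q : (V →ₗ[K] V →ₗ[K] V) × (V →ₗ[K] V →ₗ[K] V) // IsDend q.1 q.2} //
      q.1.2 = q.1.1.flip} where
  toFun B := ⟨⟨(B.op (nsOp K 0), (B.op (nsOp K 0)).flip),
    (evalTernary_zinb B.op B.op_τ).1 fun _ hs x => B.rel_relator hs x⟩, rfl⟩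
  invFun q := Alg.ofRelators (nonSymAct fun _ => q.1.1.1) (opp_opp K 1) _ (nonSymAct_opp _)
    ((evalTernary_zinb _ (nonSymAct_opp _)).2 (by
      rw [nonSymAct_nsOp, ← q.2]
      exact q.1.2))
  left_inv B := Alg.ext (nonSym_op_ext (nonSymAct_opp fun _ : Fin 1 => B.op (nsOp K 0)) B.op_τ
    fun i => by
    obtain rfl : i = 0 := Subsingleton.elim i 0
    exact nonSymAct_nsOp _ 0)
  right_inv q := by
    have h : nonSymAct (fun _ : Fin 1 => q.1.1.1) (nsOp K 0) = q.1.1.1 := nonSymAct_nsOp _ 0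
    refine Subtype.ext (Subtype.ext (Prod.ext h ?_))
    rw [q.2, ← h]
    rfl

/-- The product at the right vertex is `x ≺ y - y ≻ x`. Its vanishing for the basic product gives it
for every generator, a combination of that product and its opposite. -/
theorem atRight_mul_atRight_eq_zero_iff (A : AssBullet V (PreLieOp K)) :
    (∀ (μ : (PreLieOp K).E) (x y : V), A.1.op μ (atRight x) (atRight y) = 0) ↔
      cochainSucc A.1 = (cochainPrec A.1).flip := by
  have key : ∀ x y, A.1.op (nsOp K 0) (atRight x) (atRight y) =
      atRight (cochainPrec A.1 x y - cochainSucc A.1 y x) := fun x y => by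
    rw [op_eq_intervalMul A.1 A.2]
    refine Prod.ext (funext fun i => ?_) ?_
    · fin_cases i <;> simp [intervalMul_apply, atRight]
    · simp [intervalMul_apply, atRight]
  constructor
  · intro h
    refine LinearMap.ext₂ fun x y => ?_
    have h₁ := congrArg (fun w => w.1 1) ((key y x).symm.trans (h (nsOp K 0) y x))
    simp [atRight, sub_eq_zero] at h₁
    exact h₁.symm
  · intro h μ x y
    have h₀ : ∀ x y, A.1.op (nsOp K 0) (atRight x) (atRight y) = 0 := fun x y => by
      rw [key, h, LinearMap.flip_apply, sub_self]
      simp [atRight]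
    rw [eq_nonSymAct A.1.op A.1.op_τ, nonSymAct_apply]
    simp [h₀]

/-- Local dg pre-Lie structures on the cochains for which the product of `0`-cochains on the
right vertex vanishes are the same as dendriform structures with `x ≺ y = y ≻ x`. -/
def comBulletEquiv : ComBullet V (PreLieOp K) ≃
    {q : {q : (V →ₗ[K] V →ₗ[K] V) × (V →ₗ[K] V →ₗ[K] V) // IsDend q.1 q.2} //
      q.1.2 = q.1.1.flip} :=
  assBulletEquiv.subtypeEquiv atRight_mul_atRight_eq_zero_iff

/-! ### Cochains relative to the left vertex. -/

/-- The product `≺` on `V` associated with a dg algebra structure on the relative cochains. -/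
def relPrec (A : PreLieBullet V (PreLieOp K)) : V →ₗ[K] V →ₗ[K] V :=
  ((A.op (nsOp K 0)).compl₁₂ (LinearMap.inr K V V) (LinearMap.inl K V V)).compr₂
    (LinearMap.snd K V V)

/-- The product `≻` on `V` associated with a dg algebra structure on the relative cochains. -/
def relSucc (A : PreLieBullet V (PreLieOp K)) : V →ₗ[K] V →ₗ[K] V :=
  -(((A.op (nsOp K 0)).compl₁₂ (LinearMap.inl K V V) (LinearMap.inr K V V)).compr₂
    (LinearMap.snd K V V)).flip

theorem relPrec_apply (A : PreLieBullet V (PreLieOp K)) (x y : V) :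
    relPrec A x y = (A.op (nsOp K 0) (0, x) (y, 0)).2 := rfl

theorem relSucc_apply (A : PreLieBullet V (PreLieOp K)) (x y : V) :
    relSucc A x y = -(A.op (nsOp K 0) (y, 0) (0, x)).2 := rfl

/-- A dg pre-Lie structure on the relative cochains is determined by the two products on `V`. -/
theorem op_eq_relMul (A : PreLieBullet V (PreLieOp K)) :
    A.op (nsOp K 0) = relMul (relPrec A) (relSucc A) := by
  set m := A.op (nsOp K 0)
  have h₀₁ : ∀ x t, m (x, 0) (0, t) = (0, -relSucc A t x) := fun x t =>
    Prod.ext (A.deg_zero_one _ _ _) (by rw [relSucc_apply, neg_neg])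
  have h₁₀ : ∀ t x, m (0, t) (x, 0) = (0, relPrec A t x) := fun t x =>
    Prod.ext (A.deg_one_zero _ _ _) rfl
  have h₁₁ : ∀ t u, m (0, t) (0, u) = 0 := A.deg_one_one _
  -- As the differential is the identity, the Leibniz rule is a formula for the product of
  -- `0`-cochains; no locality is required.
  have h₀₀ : ∀ x y, m (x, 0) (y, 0) = (relPrec A x y - relSucc A y x, 0) := fun x y => by
    refine Prod.ext ?_ (A.deg_zero_zero _ _ _)
    have h := A.leibniz (nsOp K 0) x y
    simp only [LinearMap.id_apply] at h
    change (m (x, 0) (y, 0)).1 = (m (0, x) (y, 0)).2 + (m (x, 0) (0, y)).2 at h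
    rw [h, h₁₀, h₀₁, sub_eq_add_neg]
  refine LinearMap.ext₂ fun a b => ?_
  have hdec : ∀ a : V × V, a = (a.1, 0) + (0, a.2) := fun a => by simp
  conv_lhs => rw [hdec a, hdec b]
  simp only [map_add, LinearMap.add_apply, h₀₀, h₀₁, h₁₀, h₁₁]
  refine Prod.ext ?_ ?_
  · simp [relMul_apply]
  · simp [relMul_apply]
    abel

/-- The dg pre-Lie structure on the relative cochains associated with an `L`-dendriform
structure. -/
def relDGAlg (p s : V →ₗ[K] V →ₗ[K] V) (h : IsLDend p s) : PreLieBullet V (PreLieOp K) :=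
  DGAlg.ofPreLie _ (relMul p s) (isPreLie_relMul h)
    (fun a b => by simp [relMul_apply])
    (fun a b => by simp [relMul_apply])
    (fun a b => by simp [relMul_apply])
    (fun a b => by simp [relMul_apply])
    (fun a b => by simp [relMul_apply, sub_eq_add_neg])

theorem relDGAlg_op (p s : V →ₗ[K] V →ₗ[K] V) (h : IsLDend p s) :
    (relDGAlg p s h).op (nsOp K 0) = relMul p s :=
  nonSymAct_nsOp _ _

/-- Dg pre-Lie structures on the relative cochains are the same as `L`-dendriform structures. -/
def preLieBulletEquiv : PreLieBullet V (PreLieOp K) ≃ Alg (LDendOp K) V where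
  toFun A := Alg.ofRelators (nonSymAct ![relPrec A, relSucc A]) (opp_opp K 2) _ (nonSymAct_opp _)
    ((evalTernary_lDend _ (nonSymAct_opp _)).2 (by
      rw [precOp, succOp, nonSymAct_nsOp, nonSymAct_nsOp]
      exact isLDend_of_isPreLie_relMul (op_eq_relMul A ▸ A.isPreLie)))
  invFun B := relDGAlg (B.op (precOp K)) (B.op (succOp K))
    ((evalTernary_lDend B.op B.op_τ).1 fun _ hs x => B.rel_relator hs x)
  left_inv A := DGAlg.preLie_ext (by
    rw [relDGAlg_op, op_eq_relMul A]
    exact congrArg₂ relMul (nonSymAct_nsOp _ 0) (nonSymAct_nsOp _ 1))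
  right_inv B := Alg.ext (nonSym_op_ext (nonSymAct_opp _) B.op_τ fun i => by
    refine (nonSymAct_nsOp _ i).trans (LinearMap.ext₂ fun x y => ?_)
    fin_cases i
    · change relPrec _ x y = B.op (precOp K) x y
      rw [relPrec_apply, relDGAlg_op]
      simp [relMul_apply]
    · change relSucc _ x y = B.op (succOp K) x y
      rw [relSucc_apply, relDGAlg_op]
      simp [relMul_apply])

theorem intervalMul_products (p s : V →ₗ[K] V →ₗ[K] V) (x y : V) :
    intervalMul p s (atLeft x) (onEdge y) = onEdge (p x y) ∧
      intervalMul p s (onEdge x) (atRight y) = onEdge (p x y) ∧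
      intervalMul p s (atRight x) (onEdge y) = onEdge (-s y x) ∧
      intervalMul p s (onEdge x) (atLeft y) = onEdge (-s y x) := by
  refine ⟨?_, ?_, ?_, ?_⟩ <;>
    refine Prod.ext (funext fun i => ?_) ?_ <;> simp [intervalMul_apply, atLeft, atRight, onEdge]

end Equivalences

end Operads

end

theorem mainTheorem9 (K : Type u) [Field K] :
    -- Manin black products
    (Nonempty (SymOperad.Iso (black (AssOp K) (PreLieOp K)).operad (DendOp K).operad) ∧
      Nonempty (SymOperad.Iso (black (ComOp K) (PreLieOp K)).operad (ZinbOp K).operad) ∧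
      Nonempty (SymOperad.Iso (black (PreLieOp K) (PreLieOp K)).operad (LDendOp K).operad)) ∧
    -- the operads `Ass_•(preLie)`, `Com_•(preLie)` and `preLie_•(preLie)`
    (∀ (V : Type v) [AddCommGroup V] [Module K V],
      (∃ Φ : AssBullet V (PreLieOp K) ≃ Alg (DendOp K) V,
        ∀ (A : AssBullet V (PreLieOp K)) (x y : V),
          A.1.op (nsOp K 0) (atLeft x) (onEdge y) = onEdge ((Φ A).op (precOp K) x y) ∧
          A.1.op (nsOp K 0) (onEdge x) (atRight y) = onEdge ((Φ A).op (precOp K) x y) ∧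
          A.1.op (nsOp K 0) (atRight x) (onEdge y) = onEdge (-(Φ A).op (succOp K) y x) ∧
          A.1.op (nsOp K 0) (onEdge x) (atLeft y) = onEdge (-(Φ A).op (succOp K) y x)) ∧
      (∃ Φ : ComBullet V (PreLieOp K) ≃ Alg (ZinbOp K) V,
        ∀ (A : ComBullet V (PreLieOp K)) (x y : V),
          A.1.1.op (nsOp K 0) (atLeft x) (onEdge y) = onEdge ((Φ A).op (nsOp K 0) x y) ∧
          A.1.1.op (nsOp K 0) (onEdge x) (atRight y) = onEdge ((Φ A).op (nsOp K 0) x y) ∧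
          A.1.1.op (nsOp K 0) (atRight x) (onEdge y) = onEdge (-(Φ A).op (nsOp K 0) x y) ∧
          A.1.1.op (nsOp K 0) (onEdge x) (atLeft y) = onEdge (-(Φ A).op (nsOp K 0) x y)) ∧
      (∃ Φ : PreLieBullet V (PreLieOp K) ≃ Alg (LDendOp K) V,
        ∀ (A : PreLieBullet V (PreLieOp K)) (x y : V),
          A.op (nsOp K 0) (0, x) (y, 0) = (0, (Φ A).op (precOp K) x y) ∧
          A.op (nsOp K 0) (x, 0) (0, y) = (0, -(Φ A).op (succOp K) y x))) := by
  refine ⟨⟨nonempty_iso_black_ass_preLie K, nonempty_iso_black_com_preLie K,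
    nonempty_iso_black_preLie_preLie K⟩, fun V _ _ => ⟨⟨assBulletEquiv.trans dendEquiv.symm, ?_⟩,
    ⟨comBulletEquiv.trans zinbEquiv.symm, ?_⟩, ⟨preLieBulletEquiv, ?_⟩⟩⟩
  · intro A x y
    have hp : ((assBulletEquiv.trans dendEquiv.symm) A).op (precOp K) = cochainPrec A.1 :=
      nonSymAct_nsOp _ _
    have hs : ((assBulletEquiv.trans dendEquiv.symm) A).op (succOp K) = cochainSucc A.1 :=
      nonSymAct_nsOp _ _
    rw [hp, hs, op_eq_intervalMul A.1 A.2]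
    exact intervalMul_products _ _ x y
  · intro A x y
    have hp : ((comBulletEquiv.trans zinbEquiv.symm) A).op (nsOp K 0) = cochainPrec A.1.1 :=
      nonSymAct_nsOp _ _
    have hs := (atRight_mul_atRight_eq_zero_iff A.1).1 A.2
    have h := intervalMul_products (cochainPrec A.1.1) (cochainSucc A.1.1) x y
    -- Triviality at the right vertex replaces `≻` by the flip of `≺`, so all four formulas involve
    -- `⋆` alone.
    rw [← op_eq_intervalMul A.1.1 A.1.2, hs] at h
    rw [hp]
    exact h
  · intro A x y
    have hp : (preLieBulletEquiv A).op (precOp K) = relPrec A := nonSymAct_nsOp _ _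
    have hs : (preLieBulletEquiv A).op (succOp K) = relSucc A := nonSymAct_nsOp _ _
    rw [hp, hs, op_eq_relMul A]
    simp [relMul_apply]
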